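/- Let $\mathbb T=\mathbb R/\mathbb Z$, $\varphi(x)=(2\pi)^{-1}\sin(2\pi x)$, and for $\kappa>0$ let $T_\kappa:\mathbb T^2\to\mathbb T^2$ be the standard map $$T_\kappa(x,y)=(y,\,-x+2y+\kappa\,\varphi'(y)) \bmod \mathbb Z^2 .$$ Define the critical set $$\mathbf C(\kappa)=\{(x,y)\in\mathbb T^2:\ |\kappa\varphi''(x)+2|<80\pi\,\kappa^{1/2}\}.$$ A set $\Lambda\subset\mathbb T^2$ is a hyperbolic set of $T_\kappa$ if it is compact, $T_\kappa\Lambda=\Lambda$, and there are $C>0$, $\rho\in(0,1)$ and for each $p\in\Lambda$ a splitting $\mathbb R^2=E^s_p\oplus E^u_p$, invariant under $dT_\kappa$, with $\|dT_\kappa^{n}v\|\le C\rho^n\|v\|$ for $v\in E^s_p$ and $\|dT_\kappa^{-n}v\|\le C\rho^n\|v\|$ for $v\in E^u_p$, for all $n\ge 0$. It is locally maximal if $\Lambda=\bigcap_{n\in\mathbb Z}T_\kappa^n(U)$ for some open $U\supset\Lambda$. **Proposition.** There are constants $\kappa_0>1$ and $K>0$ and, for every $\kappa\ge\kappa_0$,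 a locally maximal hyperbolic set $\bar\Lambda(\kappa)$ of $T_\kappa$ with $\bar\Lambda(\kappa)\subset\mathbb T^2\setminus\mathbf C(\kappa)$, such that: (a) (the sets are dynamically increasing) for all $\kappa>\kappa^*\ge\kappa_0$ there is an injection $\iota(\kappa^*,\kappa):\bar\Lambda(\kappa^*)\to\bar\Lambda(\kappa)$ with $\iota(\kappa^*,\kappa)\circ T_{\kappa^*}=T_\kappa\circ\iota(\kappa^*,\kappa)$; with $\iota(\kappa^*,\kappa^*)=\mathrm{id}$, for every fixed $p\in\bar\Lambda(\kappa^*)$ the point $\iota(\kappa^*,\kappa)p$ is a $C^\infty$ function of $\kappa\in[\kappa^*,\infty)$; (b) for every $\kappa\ge\kappa_0$ the set $\bar\Lambda(\kappa)$ is $K\kappa^{-1/2}$-dense in $\mathbb T^2$: every point of $\mathbb T^2$ is at distance at most $K\kappa^{-1/2}$ from a point of $\bar\Lambda(\kappa)$. -/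

import Mathlib

open Set Filter Topology
open scoped ContDiff

namespace StandardFamily

/-- The two-dimensional torus `𝕋² = (ℝ/ℤ)²`, with its (product) group structure and flat metric
(maximum of the coordinate distances). -/
abbrev Torus : Type := UnitAddCircle × UnitAddCircle

/-- The tangent space of the torus at any point, by the standard trivialization. -/
abbrev Plane : Type := ℝ × ℝ

/-- The universal covering `ℝ² → 𝕋²`. -/
def proj (v : Plane) : Torus := ((v.1 : UnitAddCircle), (v.2 : UnitAddCircle))

/-! ### Differential calculus on the torus, through lifts to the plane -/

/-- The map `f : 𝕋² → 𝕋²` is differentiable at `p` with differential `L`: in the charts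
`v ↦ p + proj v` and `w ↦ f p + proj w` it is represented by a map `g` with `g 0 = 0` that has
Fréchet derivative `L` at `0`. -/
def HasTorusFDerivAt (f : Torus → Torus) (L : Plane →L[ℝ] Plane) (p : Torus) : Prop :=
  ∃ g : Plane → Plane, g 0 = 0 ∧ HasFDerivAt g L 0 ∧
    ∀ᶠ v in 𝓝 (0 : Plane), f (p + proj v) = f p + proj (g v)

theorem proj_sub (v w : Plane) : proj (v - w) = proj v - proj w := by
  simp [proj]

theorem eq_of_proj_eq_of_small {v w : Plane} (h : proj v = proj w)
    (hv : ‖v‖ < 1 / 2) (hw : ‖w‖ < 1 / 2) : v = w := by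
  have key : ∀ a b : ℝ, (a : UnitAddCircle) = (b : UnitAddCircle) → |a| < 1 / 2 → |b| < 1 / 2 →
      a = b := by
    intro a b hab ha hb
    have h0 : ((a - b : ℝ) : UnitAddCircle) = 0 := by
      rw [AddCircle.coe_sub, hab, sub_self]
    obtain ⟨n, hn⟩ := (AddCircle.coe_eq_zero_iff (1 : ℝ)).1 h0
    have hn' : (n : ℝ) = a - b := by simpa using hn
    rw [abs_lt] at ha hb
    have h1 : (n : ℝ) < 1 := by linarith
    have h2 : (-1 : ℝ) < n := by linarith
    have h3 : n < 1 := by exact_mod_cast h1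
    have h4 : -1 < n := by exact_mod_cast h2
    have h5 : n = 0 := by omega
    rw [h5] at hn'
    push_cast at hn'
    linarith
  have e1 : (v.1 : UnitAddCircle) = (w.1 : UnitAddCircle) := congrArg Prod.fst h
  have e2 : (v.2 : UnitAddCircle) = (w.2 : UnitAddCircle) := congrArg Prod.snd h
  rw [Prod.norm_def, max_lt_iff] at hv hw
  exact Prod.ext (key _ _ e1 hv.1 hw.1) (key _ _ e2 hv.2 hw.2)

/-- The differential is unique. -/
theorem HasTorusFDerivAt.unique {f : Torus → Torus} {L L' : Plane →L[ℝ] Plane} {p : Torus}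
    (h : HasTorusFDerivAt f L p) (h' : HasTorusFDerivAt f L' p) : L = L' := by
  obtain ⟨g, g0, hg, eg⟩ := h
  obtain ⟨k, k0, hk, ek⟩ := h'
  have small : ∀ u : Plane → Plane, u 0 = 0 → ContinuousAt u 0 →
      ∀ᶠ v in 𝓝 (0 : Plane), ‖u v‖ < 1 / 2 := by
    intro u u0 hu
    have ht : Tendsto (fun v => ‖u v‖) (𝓝 0) (𝓝 0) := by
      have := hu.norm
      simpa [ContinuousAt, u0] using this
    exact ht.eventually (gt_mem_nhds (by norm_num))
  have e : g =ᶠ[𝓝 0] k := by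
    filter_upwards [eg, ek, small g g0 hg.continuousAt, small k k0 hk.continuousAt]
      with v h1 h2 h3 h4
    exact eq_of_proj_eq_of_small (add_left_cancel (h1.symm.trans h2)) h3 h4
  exact hg.unique (hk.congr_of_eventuallyEq e)

open Classical in
/-- The differential of `f` at `p` (equal to `0` by convention if `f` is not differentiable
at `p`). -/
noncomputable def torusFDeriv (f : Torus → Torus) (p : Torus) : Plane →L[ℝ] Plane :=
  if h : ∃ L, HasTorusFDerivAt f L p then h.choose else 0

theorem HasTorusFDerivAt.torusFDeriv_eq {f : Torus → Torus} {L : Plane →L[ℝ] Plane} {p : Torus}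
    (h : HasTorusFDerivAt f L p) : torusFDeriv f p = L := by
  have hex : ∃ L, HasTorusFDerivAt f L p := ⟨L, h⟩
  rw [torusFDeriv, dif_pos hex]
  exact hex.choose_spec.unique h

/-- A curve `c` in the torus is `C^∞` on the interval `I` if it has a lift to the plane that is
`C^∞` on `I`. -/
def SmoothTorusCurveOn (c : ℝ → Torus) (I : Set ℝ) : Prop :=
  ∃ g : ℝ → Plane, ContDiffOn ℝ ∞ g I ∧ ∀ t ∈ I, proj (g t) = c t

/-! ### Hyperbolic sets -/

/-- `Λ` is a (uniformly) hyperbolic set of the invertible map `f` of the torus: it is compact and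
invariant, `f` and its inverse are differentiable at its points, and the tangent spaces over `Λ`
split into two subspaces `Es`, `Eu`, invariant under the differential, the first being uniformly
exponentially contracted by the iterates of `f` and the second by the iterates of `f⁻¹`. -/
def IsHyperbolicSet (f : Equiv.Perm Torus) (Λ : Set Torus) : Prop :=
  IsCompact Λ ∧ f '' Λ = Λ ∧
  (∀ p ∈ Λ, (∃ L, HasTorusFDerivAt f L p) ∧ (∃ L, HasTorusFDerivAt f.symm L p)) ∧
  ∃ (Es Eu : Torus → Submodule ℝ Plane) (C ρ : ℝ), 0 < C ∧ 0 < ρ ∧ ρ < 1 ∧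
    ∀ p ∈ Λ,
      IsCompl (Es p) (Eu p) ∧
      (Es p).map (torusFDeriv f p).toLinearMap = Es (f p) ∧
      (Eu p).map (torusFDeriv f p).toLinearMap = Eu (f p) ∧
      (∀ n : ℕ, ∀ v ∈ Es p, ‖torusFDeriv (f^[n]) p v‖ ≤ C * ρ ^ n * ‖v‖) ∧
      (∀ n : ℕ, ∀ v ∈ Eu p, ‖torusFDeriv (f.symm^[n]) p v‖ ≤ C * ρ ^ n * ‖v‖)

/-- A hyperbolic set is locally maximal if it is the set of all points whose full orbit stays in
some open neighbourhood of it. -/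
def IsLocallyMaximalHyperbolicSet (f : Equiv.Perm Torus) (Λ : Set Torus) : Prop :=
  IsHyperbolicSet f Λ ∧ ∃ U : Set Torus, IsOpen U ∧ Λ ⊆ U ∧ Λ = ⋂ n : ℤ, (f ^ n) '' U

/-! ### The standard family and its critical set -/

/-- The function `φ(x) = (2π)⁻¹ sin(2πx)`. -/
noncomputable def phi (x : ℝ) : ℝ := (2 * Real.pi)⁻¹ * Real.sin (2 * Real.pi * x)

theorem deriv_phi : deriv phi = fun x => Real.cos (2 * Real.pi * x) := by
  funext x
  have h1 : HasDerivAt (fun x : ℝ => 2 * Real.pi * x) (2 * Real.pi) x := by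
    simpa using (hasDerivAt_id x).const_mul (2 * Real.pi)
  have h : HasDerivAt phi ((2 * Real.pi)⁻¹ * (Real.cos (2 * Real.pi * x) * (2 * Real.pi))) x :=
    h1.sin.const_mul _
  rw [h.deriv]
  field_simp

theorem deriv_deriv_phi :
    deriv (deriv phi) = fun x => -(2 * Real.pi) * Real.sin (2 * Real.pi * x) := by
  rw [deriv_phi]
  funext x
  have h1 : HasDerivAt (fun x : ℝ => 2 * Real.pi * x) (2 * Real.pi) x := by
    simpa using (hasDerivAt_id x).const_mul (2 * Real.pi)
  rw [h1.cos.deriv]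
  ring

theorem periodic_deriv_phi : Function.Periodic (deriv phi) 1 := by
  intro x
  rw [deriv_phi]
  simp [mul_add]

theorem periodic_deriv_deriv_phi : Function.Periodic (deriv (deriv phi)) 1 := by
  intro x
  rw [deriv_deriv_phi]
  simp [mul_add]

/-- The derivative `φ'`, as a function on the circle `ℝ/ℤ`. -/
noncomputable def phiDot : UnitAddCircle → ℝ := periodic_deriv_phi.lift

/-- The second derivative `φ''`, as a function on the circle `ℝ/ℤ`. -/
noncomputable def phiDDot : UnitAddCircle → ℝ := periodic_deriv_deriv_phi.lift

/-- The standard map `(x, y) ↦ (y, -x + 2y + κ φ'(y)) mod ℤ²`, with its inverse. -/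
noncomputable def standardMap (κ : ℝ) : Equiv.Perm Torus where
  toFun p := (p.2, -p.1 + (2 : ℕ) • p.2 + ((κ * phiDot p.2 : ℝ) : UnitAddCircle))
  invFun p := (-p.2 + (2 : ℕ) • p.1 + ((κ * phiDot p.1 : ℝ) : UnitAddCircle), p.1)
  left_inv p := by
    ext
    · simp only
      abel
    · rfl
  right_inv p := by
    ext
    · rfl
    · simp only
      abel

/-- The `κ`-adapted slope `φ''(x) + 2/κ`: the image under the differential of the standard map of
the vertical direction at the preimage of `p = (x, y)` has slope `κ` times this number. -/
noncomputable def slopeOne (κ : ℝ) (p : Torus) : ℝ := phiDDot p.1 + 2 / κ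

/-- The critical set with parameter `τ`: the points with `|κ h₁(p)| < τ κ^{1/2}`. -/
def criticalSetWith (κ τ : ℝ) : Set Torus :=
  {p | |κ * slopeOne κ p| < τ * κ ^ (1 / 2 : ℝ)}

/-- The critical set `C(κ)`, for the fixed choice `τ = 80π`. -/
noncomputable def criticalSet (κ : ℝ) : Set Torus := criticalSetWith κ (80 * Real.pi)

end StandardFamily

open StandardFamily

/-! The construction works near the anti-integrable limit. The first coordinates of an orbit, lifted
to `(-1/2, 1/2)`, satisfy `X (n+1) + X (n-1) + a n = 2 X n + κ cos (2π X n)` with integers `a n`.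
Solved for the cosine, this says that `X n` is a branch of `arccos / 2π`, evaluated at a quantity in
which the lifts carry the factor `1/κ`. The signs `u n` choose the branch. The bound `|a n| ≤ κ -
2000` keeps the cosine `1998/κ` away from `±1`, where `arccos` has Lipschitz constant at most `√κ`.
The equation thus becomes a fixed point problem for a sup-norm contraction, and each code `(u, a)`
has exactly one orbit (`exists_isCodedOrbit`, `IsCodedOrbit.unique`). The hyperbolic set is
`codedSet κ`, the set of points of these orbits.

The same margin gives `|sin (2π X n)| ≥ 44/√κ`, so coded orbits avoid the critical set and the
slopes `2 - 2πκ sin (2π X n)` are large. The invariant directions are then continued fractions in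
these slopes, contracted by 1/2 at each step. Compactness and local maximality hold because an orbit
that stays in a suitable window is coded.

The codes allowed at `κ` remain allowed at larger parameters, and following the point with a fixed
code gives the injections. Smoothness in `κ` is the implicit function theorem on bounded sequences
(`IsCodedOrbit.exists_smooth_continuation`). For density, the symbols at times 0 and 1 already
determine both coordinates up to `16/√κ`. -/

namespace StandardFamily

open scoped BoundedContinuousFunction

/-! ### Contractions of sequences and estimates for arccos and cosine -/

/-- A self-map of the `B`-ball of bounded sequences which halves the sup distance has a fixed
point. -/
theorem exists_fixedPoint_of_halving {B : ℝ} (hB : 0 ≤ B) (Φ : (ℤ → ℝ) → ℤ → ℝ)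
    (bound : ∀ x, (∀ n, |x n| ≤ B) → ∀ n, |Φ x n| ≤ B)
    (contr : ∀ x y, (∀ n, |x n| ≤ B) → (∀ n, |y n| ≤ B) → ∀ d, (∀ n, |x n - y n| ≤ d) →
      ∀ n, |Φ x n - Φ y n| ≤ d / 2) :
    ∃ x, (∀ n, |x n| ≤ B) ∧ Φ x = x := by
  -- Clamping to `[-B, B]` is 1-Lipschitz, so it extends `Φ` to a contraction of the whole complete
  -- space of bounded sequences.
  let cl : ℝ → ℝ := fun t => max (-B) (min B t)
  have clB : ∀ t, |cl t| ≤ B := fun t =>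
    abs_le.2 ⟨le_max_left _ _, max_le (by linarith) (min_le_left _ _)⟩
  have clid : ∀ t, |t| ≤ B → cl t = t := by
    intro t ht
    rw [abs_le] at ht
    simp only [cl]
    rw [min_eq_right ht.2, max_eq_right ht.1]
  have cldist : ∀ s t, |cl s - cl t| ≤ |s - t| := by
    intro s t
    simp only [cl]
    refine (abs_max_sub_max_le_max _ _ _ _).trans ?_
    simp only [sub_self, abs_zero]
    refine max_le (abs_nonneg _) ((abs_min_sub_min_le_max _ _ _ _).trans ?_)
    simp
  let Ψ : (ℤ →ᵇ ℝ) → (ℤ →ᵇ ℝ) := fun x =>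
    BoundedContinuousFunction.ofNormedAddCommGroupDiscrete (Φ fun n => cl (x n)) B
      (fun n => bound _ (fun m => clB _) n)
  have hΨ : ContractingWith (1 / 2) Ψ := by
    refine ⟨by norm_num [← NNReal.coe_lt_coe], LipschitzWith.of_dist_le_mul fun x y => ?_⟩
    rw [BoundedContinuousFunction.dist_le (by positivity)]
    intro n
    have := contr (fun n => cl (x n)) (fun n => cl (y n)) (fun _ => clB _) (fun _ => clB _)
      (dist x y) (fun m => (cldist _ _).trans (by
        rw [← Real.dist_eq]; exact BoundedContinuousFunction.dist_coe_le_dist m)) n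
    rw [Real.dist_eq]
    calc _ ≤ dist x y / 2 := this
      _ = _ := by push_cast; ring
  set x := hΨ.fixedPoint Ψ
  have hx : Ψ x = x := hΨ.fixedPoint_isFixedPt
  have hx' : ∀ n, Φ (fun m => cl (x m)) n = x n := fun n => DFunLike.congr_fun hx n
  have hxB : ∀ n, |x n| ≤ B := fun n => hx' n ▸ bound _ (fun m => clB _) n
  refine ⟨x, hxB, funext fun n => ?_⟩
  rw [← hx' n]
  congr 1
  exact funext fun m => (clid _ (hxB m)).symm

/-- Two sequences at finite distance coincide if every bound for the distance can be halved. -/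
theorem eq_of_halving {x y : ℤ → ℝ} {D : ℝ} (hD : ∀ n, |x n - y n| ≤ D)
    (h : ∀ d, (∀ n, |x n - y n| ≤ d) → ∀ n, |x n - y n| ≤ d / 2) : x = y := by
  have key : ∀ k : ℕ, ∀ n, |x n - y n| ≤ D * (1 / 2) ^ k := by
    intro k
    induction k with
    | zero => simpa using hD
    | succ k ih => intro n; have := h _ ih n; rw [pow_succ]; linarith
  funext n
  have ht : Tendsto (fun k : ℕ => D * (1 / 2 : ℝ) ^ k) atTop (𝓝 (D * 0)) :=
    (tendsto_pow_atTop_nhds_zero_of_lt_one (by norm_num) (by norm_num)).const_mul D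
  have := ge_of_tendsto' ht (fun k => key k n)
  rw [mul_zero] at this
  exact sub_eq_zero.1 (abs_nonpos_iff.1 this)

theorem abs_arccos_sub_arccos_le {r s t : ℝ} (hr : r < 1) (hs : |s| ≤ r) (ht : |t| ≤ r) :
    |Real.arccos s - Real.arccos t| ≤ (Real.sqrt (1 - r ^ 2))⁻¹ * |s - t| := by
  have hr0 : 0 ≤ r := (abs_nonneg s).trans hs
  have hpos : 0 < 1 - r ^ 2 := by nlinarith
  have hd : ∀ x ∈ Icc (-r) r,
      HasDerivWithinAt Real.arccos (-(1 / Real.sqrt (1 - x ^ 2))) (Icc (-r) r) x := fun x hx =>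
    (Real.hasDerivAt_arccos (by linarith [hx.1]) (by linarith [hx.2])).hasDerivWithinAt
  refine Convex.norm_image_sub_le_of_norm_hasDerivWithin_le hd (fun x hx => ?_)
    (convex_Icc _ _) (abs_le.1 ht) (abs_le.1 hs)
  rw [norm_neg, one_div, norm_inv, Real.norm_of_nonneg (Real.sqrt_nonneg _)]
  have : x ^ 2 ≤ r ^ 2 := sq_le_sq' hx.1 hx.2
  exact inv_anti₀ (Real.sqrt_pos.2 hpos) (Real.sqrt_le_sqrt (by linarith))

/-- The lower bound for the variation of the cosine on a half period. -/
theorem sq_sub_le_abs_cos_sub_cos {x y : ℝ} (hx0 : 0 ≤ x) (hx : x ≤ 1 / 2) (hy0 : 0 ≤ y)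
    (hy : y ≤ 1 / 2) :
    8 * (x - y) ^ 2 ≤ |Real.cos (2 * Real.pi * x) - Real.cos (2 * Real.pi * y)| := by
  wlog hxy : x ≤ y generalizing x y
  · have := this hy0 hy hx0 hx (le_of_not_ge hxy)
    rw [abs_sub_comm]
    linarith
  have pi0 := Real.pi_pos
  rw [Real.cos_sub_cos]
  have e1 : (2 * Real.pi * x + 2 * Real.pi * y) / 2 = Real.pi * (x + y) := by ring
  have e2 : (2 * Real.pi * x - 2 * Real.pi * y) / 2 = -(Real.pi * (y - x)) := by ring
  rw [e1, e2, Real.sin_neg]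
  have hd : 0 ≤ y - x := sub_nonneg.2 hxy
  have h1 : 2 * (y - x) ≤ Real.sin (Real.pi * (y - x)) := by
    have := Real.mul_le_sin (x := Real.pi * (y - x)) (by positivity) (by nlinarith)
    calc 2 * (y - x) = 2 / Real.pi * (Real.pi * (y - x)) := by field_simp
      _ ≤ _ := this
  have h2 : 2 * (y - x) ≤ Real.sin (Real.pi * (x + y)) := by
    -- Jordan's inequality needs an angle at most `π/2`, so a larger angle is reflected to `π (1 -
    -- (x + y))`. Both `x + y` and `1 - (x + y)` are at least `y - x`.
    rcases le_total (x + y) (1 / 2) with h | h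
    · have := Real.mul_le_sin (x := Real.pi * (x + y)) (by positivity) (by nlinarith)
      calc 2 * (y - x) ≤ 2 * (x + y) := by linarith
        _ = 2 / Real.pi * (Real.pi * (x + y)) := by field_simp
        _ ≤ _ := this
    · have := Real.mul_le_sin (x := Real.pi * (1 - (x + y)))
        (mul_nonneg pi0.le (by linarith)) (by nlinarith)
      calc 2 * (y - x) ≤ 2 * (1 - (x + y)) := by linarith
        _ = 2 / Real.pi * (Real.pi * (1 - (x + y))) := by field_simp
        _ ≤ Real.sin (Real.pi * (1 - (x + y))) := this
        _ = _ := by rw [mul_sub, mul_one, Real.sin_pi_sub]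
  have h3 : 2 * (y - x) * (2 * (y - x)) ≤
      Real.sin (Real.pi * (x + y)) * Real.sin (Real.pi * (y - x)) :=
    mul_le_mul h2 h1 (by positivity) (by linarith)
  calc 8 * (x - y) ^ 2 = 2 * (2 * (y - x) * (2 * (y - x))) := by ring
    _ ≤ 2 * (Real.sin (Real.pi * (x + y)) * Real.sin (Real.pi * (y - x))) := by linarith
    _ = -2 * Real.sin (Real.pi * (x + y)) * -Real.sin (Real.pi * (y - x)) := by ring
    _ ≤ _ := le_abs_self _

theorem abs_sign_mul (u : ℤˣ) (x : ℝ) : |((u : ℤ) : ℝ) * x| = |x| := by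
  rcases Int.units_eq_one_or u with rfl | rfl <;> simp

theorem sign_mul_sign_mul (u : ℤˣ) (x : ℝ) : ((u : ℤ) : ℝ) * (((u : ℤ) : ℝ) * x) = x := by
  rcases Int.units_eq_one_or u with rfl | rfl <;> simp

theorem cos_sign_mul (u : ℤˣ) (x : ℝ) : Real.cos (((u : ℤ) : ℝ) * x) = Real.cos x := by
  rcases Int.units_eq_one_or u with rfl | rfl <;> simp

/-! ### Coded orbits: existence and uniqueness -/

/-- `X` is the lift to the intervals `(0, 1/2)` and `(-1/2, 0)` of an orbit of the standard map;
the code of the orbit is given by the signs `u` and the integer translations `a`. -/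
structure IsCodedOrbit (κ : ℝ) (u : ℤ → ℤˣ) (a : ℤ → ℤ) (X : ℤ → ℝ) : Prop where
  pos : ∀ n, 0 < ((u n : ℤ) : ℝ) * X n
  lt : ∀ n, ((u n : ℤ) : ℝ) * X n < 1 / 2
  eq : ∀ n, X (n + 1) + X (n - 1) + a n = 2 * X n + κ * Real.cos (2 * Real.pi * X n)

/-- The translations allowed at the parameter `κ`. -/
def Admissible (κ : ℝ) (a : ℤ → ℤ) : Prop := ∀ n, |(a n : ℝ)| ≤ κ - 2000

theorem Admissible.mono {κ κ' : ℝ} {a : ℤ → ℤ} (h : Admissible κ a) (hκ : κ ≤ κ') :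
    Admissible κ' a := fun n => (h n).trans (by linarith)

/-- The three lifts contribute at most `1/2 + 1/2 + 2 · 1/2 = 2`, which turns 2000 into 1998. -/
theorem abs_cos_le_of_step {κ a x y z : ℝ} (hκ : 0 < κ) (ha : |a| ≤ κ - 2000)
    (hx : |x| ≤ 1 / 2) (hy : |y| ≤ 1 / 2) (hz : |z| ≤ 1 / 2)
    (h : z + y + a = 2 * x + κ * Real.cos (2 * Real.pi * x)) :
    |Real.cos (2 * Real.pi * x)| ≤ 1 - 1998 / κ := by
  have h1 : |κ * Real.cos (2 * Real.pi * x)| ≤ κ - 1998 := by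
    rw [abs_le] at *
    constructor <;> linarith
  rw [abs_mul, abs_of_pos hκ] at h1
  rw [show 1 - 1998 / κ = (κ - 1998) / κ by field_simp, le_div_iff₀ hκ]
  linarith

/-- With `c = 1998/κ ≤ 1`, one has `sin² ≥ 1 - (1 - c)² ≥ c`, and `44² = 1936 ≤ 1998`. -/
theorem le_abs_sin_of_abs_cos_le {κ θ : ℝ} (hκ : 3000 ≤ κ)
    (h : |Real.cos θ| ≤ 1 - 1998 / κ) : 44 / Real.sqrt κ ≤ |Real.sin θ| := by
  have h1 := Real.sin_sq_add_cos_sq θ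
  have hk : 0 < κ := by linarith
  have hc : 0 < 1998 / κ := by positivity
  have hc1 : 1998 / κ ≤ 1 := by rw [div_le_one hk]; linarith
  have h2 : Real.cos θ ^ 2 ≤ (1 - 1998 / κ) ^ 2 := sq_le_sq' (abs_le.1 h).1 (abs_le.1 h).2
  refine (sq_le_sq₀ (by positivity) (abs_nonneg _)).1 ?_
  rw [div_pow, Real.sq_sqrt hk.le, sq_abs]
  have h3 : (44 : ℝ) ^ 2 / κ ≤ 1998 / κ := by gcongr; norm_num
  nlinarith

theorem IsCodedOrbit.abs_lift_eq {κ : ℝ} {u : ℤ → ℤˣ} {a : ℤ → ℤ} {X : ℤ → ℝ}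
    (h : IsCodedOrbit κ u a X) (n : ℤ) : |X n| = ((u n : ℤ) : ℝ) * X n := by
  rw [← abs_sign_mul (u n), abs_of_pos (h.pos n)]

theorem IsCodedOrbit.abs_lift_lt {κ : ℝ} {u : ℤ → ℤˣ} {a : ℤ → ℤ} {X : ℤ → ℝ}
    (h : IsCodedOrbit κ u a X) (n : ℤ) : |X n| < 1 / 2 := h.abs_lift_eq n ▸ h.lt n

theorem IsCodedOrbit.abs_cos_lift_le {κ : ℝ} {u : ℤ → ℤˣ} {a : ℤ → ℤ} {X : ℤ → ℝ}
    (h : IsCodedOrbit κ u a X) (ha : Admissible κ a) (hκ : 3000 ≤ κ) (n : ℤ) :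
    |Real.cos (2 * Real.pi * X n)| ≤ 1 - 1998 / κ :=
  abs_cos_le_of_step (by linarith) (ha n) (h.abs_lift_lt n).le (h.abs_lift_lt (n - 1)).le
    (h.abs_lift_lt (n + 1)).le (h.eq n)

/-- Points with bounded cosine stay away from `0` and `1/2`. -/
theorem gap_of_abs_cos_le {κ x : ℝ} (hκ : 3000 ≤ κ) (hx : |x| ≤ 1 / 2)
    (h : |Real.cos (2 * Real.pi * x)| ≤ 1 - 1998 / κ) :
    1 / Real.sqrt κ ≤ |x| ∧ |x| ≤ 1 / 2 - 1 / Real.sqrt κ := by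
  have hs := le_abs_sin_of_abs_cos_le hκ h
  have hk : 0 < Real.sqrt κ := Real.sqrt_pos.2 (by linarith)
  have pi4 := Real.pi_lt_four
  have pi0 := Real.pi_pos
  have key : ∀ y, 0 ≤ y → 44 / Real.sqrt κ ≤ 2 * Real.pi * y → 1 / Real.sqrt κ ≤ y := by
    intro y hy h
    rw [div_le_iff₀ hk] at *
    nlinarith [mul_nonneg hy hk.le]
  have e : |Real.sin (2 * Real.pi * x)| = |Real.sin (2 * Real.pi * (1 / 2 - |x|))| := by
    rw [show 2 * Real.pi * (1 / 2 - |x|) = Real.pi - 2 * Real.pi * |x| by ring, Real.sin_pi_sub]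
    rcases abs_cases x with h | h <;> simp [h.1]
  refine ⟨key _ (abs_nonneg _) (hs.trans ?_), ?_⟩
  · refine (Real.abs_sin_le_abs).trans (le_of_eq ?_)
    rw [abs_mul, abs_of_pos (by positivity)]
  · have := key (1 / 2 - |x|) (by linarith) (hs.trans ?_)
    · linarith
    · rw [e]
      refine (Real.abs_sin_le_abs).trans (le_of_eq ?_)
      rw [abs_mul, abs_of_pos (by positivity), abs_of_nonneg (by linarith : 0 ≤ 1 / 2 - |x|)]

/-- On this range `arccos` is `√κ`-Lipschitz, so the values differ by at most `4d/√κ ≤ d`; dividing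
by `2π` leaves less than `d/2`. -/
theorem arccos_halving {κ : ℝ} (hκ : 3000 ≤ κ) {s t d : ℝ}
    (hs : |s| ≤ 1 - 1998 / κ) (ht : |t| ≤ 1 - 1998 / κ) (hst : |s - t| ≤ 4 * d / κ) :
    |Real.arccos s / (2 * Real.pi) - Real.arccos t / (2 * Real.pi)| ≤ d / 2 := by
  have hk : 0 < κ := by linarith
  have hsk : 0 < Real.sqrt κ := Real.sqrt_pos.2 hk
  have hd : 0 ≤ d := by
    have := (abs_nonneg _).trans hst
    rw [le_div_iff₀ hk] at this
    linarith
  have h0 : 0 < 1998 / κ := by positivity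
  have h1 := abs_arccos_sub_arccos_le (by linarith) hs ht
  have h1' : (1 : ℝ) / κ ≤ 1 - (1 - 1998 / κ) ^ 2 := by
    have hc1 : 1998 / κ ≤ 1 := by rw [div_le_one hk]; linarith
    have : (1 : ℝ) / κ ≤ 1998 / κ := by gcongr; norm_num
    nlinarith
  have h2 : (Real.sqrt (1 - (1 - 1998 / κ) ^ 2))⁻¹ ≤ Real.sqrt κ := by
    rw [inv_le_comm₀ (Real.sqrt_pos.2 (lt_of_lt_of_le (by positivity) h1')) hsk]
    rw [← Real.sqrt_inv]
    exact Real.sqrt_le_sqrt (by rwa [← one_div])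
  have h3 : |Real.arccos s - Real.arccos t| ≤ d := by
    calc _ ≤ Real.sqrt κ * (4 * d / κ) := h1.trans (by gcongr)
      _ = 4 * d / Real.sqrt κ := by
        nth_rewrite 2 [← Real.sq_sqrt hk.le]
        field_simp
      _ ≤ d := by
        rw [div_le_iff₀ hsk]
        have : (4 : ℝ) ≤ Real.sqrt κ := Real.le_sqrt_of_sq_le (by linarith)
        nlinarith
  have pi3 := Real.pi_gt_three
  rw [← sub_div, abs_div, abs_of_pos (by positivity : 0 < 2 * Real.pi),
    div_le_iff₀ (by positivity)]
  nlinarith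

theorem abs_step_le {κ a x y z : ℝ} (hκ : 0 < κ) (ha : |a| ≤ κ - 2000)
    (hx : |x| ≤ 1 / 2) (hy : |y| ≤ 1 / 2) (hz : |z| ≤ 1 / 2) :
    |(a + z + y - 2 * x) / κ| ≤ 1 - 1998 / κ := by
  rw [abs_div, abs_of_pos hκ, div_le_iff₀ hκ, sub_mul, div_mul_cancel₀ _ hκ.ne']
  rw [abs_le] at *
  constructor <;> linarith

theorem abs_step_sub_le {κ a x y z x' y' z' d : ℝ} (hκ : 0 < κ) (hx : |x - x'| ≤ d)
    (hy : |y - y'| ≤ d) (hz : |z - z'| ≤ d) :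
    |(a + z + y - 2 * x) / κ - (a + z' + y' - 2 * x') / κ| ≤ 4 * d / κ := by
  rw [← sub_div, abs_div, abs_of_pos hκ]
  refine div_le_div_of_nonneg_right ?_ hκ.le
  rw [abs_le] at *
  constructor <;> linarith

theorem exists_isCodedOrbit {κ : ℝ} (hκ : 3000 ≤ κ) (u : ℤ → ℤˣ) {a : ℤ → ℤ}
    (ha : Admissible κ a) : ∃ X, IsCodedOrbit κ u a X := by
  have hk : 0 < κ := by linarith
  have pi0 := Real.pi_pos
  obtain ⟨X, hXB, hX⟩ := exists_fixedPoint_of_halving (B := 1 / 2) (by norm_num)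
    (fun x n => ((u n : ℤ) : ℝ) *
      (Real.arccos ((a n + x (n + 1) + x (n - 1) - 2 * x n) / κ) / (2 * Real.pi)))
    (by
      intro x _ n
      rw [abs_sign_mul, abs_of_nonneg (div_nonneg (Real.arccos_nonneg _) (by positivity)),
        div_le_iff₀ (by positivity)]
      linarith [Real.arccos_le_pi ((a n + x (n + 1) + x (n - 1) - 2 * x n) / κ)])
    (by
      intro x y hx hy d hd n
      rw [← mul_sub, abs_sign_mul]
      exact arccos_halving hκ (abs_step_le hk (ha n) (hx _) (hx _) (hx _))
        (abs_step_le hk (ha n) (hy _) (hy _) (hy _)) (abs_step_sub_le hk (hd _) (hd _) (hd _)))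
  have hXn := fun n => congrFun hX n
  have hu : ∀ n, ((u n : ℤ) : ℝ) * X n =
      Real.arccos ((a n + X (n + 1) + X (n - 1) - 2 * X n) / κ) / (2 * Real.pi) := by
    intro n
    conv_lhs => rw [← hXn n]
    exact sign_mul_sign_mul _ _
  have heq : ∀ n, X (n + 1) + X (n - 1) + a n = 2 * X n + κ * Real.cos (2 * Real.pi * X n) := by
    intro n
    -- The argument of `arccos` lies in `[-1, 1]`, so the cosine does undo it.
    have hb := abs_le.1 (abs_step_le hk (ha n) (hXB n) (hXB (n - 1)) (hXB (n + 1)))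
    have h0 : 0 < 1998 / κ := by positivity
    rw [← cos_sign_mul (u n), show ((u n : ℤ) : ℝ) * (2 * Real.pi * X n) =
      2 * Real.pi * (((u n : ℤ) : ℝ) * X n) by ring, hu n, mul_div_cancel₀ _ (by positivity),
      Real.cos_arccos (by linarith) (by linarith)]
    field_simp
    ring
  have hnn : ∀ n, |X n| = ((u n : ℤ) : ℝ) * X n := by
    intro n
    rw [← abs_sign_mul (u n), abs_of_nonneg]
    rw [hu n]
    exact div_nonneg (Real.arccos_nonneg _) (by positivity)
  -- The fixed point only gives `0 ≤ u n * X n ≤ 1/2`; the gap makes both inequalities strict.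
  have hgap := fun n => gap_of_abs_cos_le hκ (hXB n)
    (abs_cos_le_of_step hk (ha n) (hXB n) (hXB (n - 1)) (hXB (n + 1)) (heq n))
  have hsk : 0 < 1 / Real.sqrt κ := one_div_pos.2 (Real.sqrt_pos.2 hk)
  refine ⟨X, fun n => ?_, fun n => ?_, heq⟩
  · have := (hgap n).1
    rw [hnn] at this
    linarith
  · have := (hgap n).2
    rw [hnn] at this
    linarith

/-- The converse of the construction: every coded orbit is a fixed point of the contraction, which
yields uniqueness. -/
theorem IsCodedOrbit.eq_arccos {κ : ℝ} {u : ℤ → ℤˣ} {a : ℤ → ℤ} {X : ℤ → ℝ}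
    (h : IsCodedOrbit κ u a X) (hκ : 0 < κ) (n : ℤ) :
    X n = ((u n : ℤ) : ℝ) *
      (Real.arccos ((a n + X (n + 1) + X (n - 1) - 2 * X n) / κ) / (2 * Real.pi)) := by
  have pi0 := Real.pi_pos
  have e : (a n + X (n + 1) + X (n - 1) - 2 * X n) / κ =
      Real.cos (2 * Real.pi * (((u n : ℤ) : ℝ) * X n)) := by
    rw [show 2 * Real.pi * (((u n : ℤ) : ℝ) * X n) = ((u n : ℤ) : ℝ) * (2 * Real.pi * X n) by ring,
      cos_sign_mul, div_eq_iff hκ.ne']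
    linarith [h.eq n]
  have h1 := h.pos n
  have h2 := h.lt n
  rw [e, Real.arccos_cos (by positivity) (by nlinarith), mul_div_cancel_left₀ _ (by positivity),
    sign_mul_sign_mul]

theorem IsCodedOrbit.unique {κ : ℝ} (hκ : 3000 ≤ κ) {u : ℤ → ℤˣ} {a : ℤ → ℤ}
    (ha : Admissible κ a) {X Y : ℤ → ℝ} (hX : IsCodedOrbit κ u a X)
    (hY : IsCodedOrbit κ u a Y) : X = Y := by
  have hk : 0 < κ := by linarith
  refine eq_of_halving (D := 1) (fun n => ?_) fun d hd n => ?_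
  · have h1 := abs_lt.1 (hX.abs_lift_lt n)
    have h2 := abs_lt.1 (hY.abs_lift_lt n)
    rw [abs_le]
    constructor <;> linarith
  · rw [hX.eq_arccos hk n, hY.eq_arccos hk n, ← mul_sub, abs_sign_mul]
    exact arccos_halving hκ
      (abs_step_le hk (ha n) (hX.abs_lift_lt _).le (hX.abs_lift_lt _).le (hX.abs_lift_lt _).le)
      (abs_step_le hk (ha n) (hY.abs_lift_lt _).le (hY.abs_lift_lt _).le (hY.abs_lift_lt _).le)
      (abs_step_sub_le hk (hd _) (hd _) (hd _))

/-! ### Symbols near a given point, and lower bounds for slopes -/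

/-- Rounding towards zero does not leave `[-R, R]`. -/
theorem exists_int_near {t R : ℝ} (ht : |t| ≤ R) : ∃ a : ℤ, |(a : ℝ)| ≤ R ∧ |(a : ℝ) - t| ≤ 1 := by
  rw [abs_le] at ht
  have h1 := Int.floor_le t
  have h2 := Int.lt_floor_add_one t
  have h3 := Int.le_ceil t
  have h4 := Int.ceil_lt_add_one t
  rcases le_total 0 t with h | h
  · have h0 : (0 : ℝ) ≤ ⌊t⌋ := by exact_mod_cast Int.floor_nonneg.2 h
    exact ⟨⌊t⌋, abs_le.2 ⟨by linarith, by linarith⟩, abs_le.2 ⟨by linarith, by linarith⟩⟩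
  · have h0 : (⌈t⌉ : ℝ) ≤ 0 := by
      have : ⌈t⌉ ≤ 0 := Int.ceil_le.2 (by simpa using h)
      exact_mod_cast this
    exact ⟨⌈t⌉, abs_le.2 ⟨by linarith, by linarith⟩, abs_le.2 ⟨by linarith, by linarith⟩⟩

/-- Every point is close to the points of all coded orbits with a suitable symbol. -/
theorem exists_symbol_near {κ : ℝ} (hκ : 3000 ≤ κ) {x : ℝ} (hx : |x| ≤ 1 / 2) :
    ∃ (s : ℤˣ) (b : ℤ), |(b : ℝ)| ≤ κ - 2000 ∧
      ∀ u a X, IsCodedOrbit κ u a X → ∀ n, u n = s → a n = b →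
        |x - X n| ≤ 16 / Real.sqrt κ := by
  have hk : 0 < κ := by linarith
  obtain ⟨s, hs⟩ : ∃ s : ℤˣ, ((s : ℤ) : ℝ) * x = |x| := by
    rcases le_total 0 x with h | h
    · exact ⟨1, by simp [abs_of_nonneg h]⟩
    · exact ⟨-1, by simp [abs_of_nonpos h]⟩
  set c := Real.cos (2 * Real.pi * x) with hc
  have hc1 : |c| ≤ 1 := Real.abs_cos_le_one _
  -- The ideal translation `κ c` may be inadmissible; scaling it to `(κ - 2000) c` costs at most
  -- 2000.
  obtain ⟨b, hb, hbt⟩ := exists_int_near (t := (κ - 2000) * c) (R := κ - 2000) (by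
    rw [abs_mul, abs_of_nonneg (by linarith)]
    nlinarith)
  refine ⟨s, b, hb, fun u a X hX n hu ha => ?_⟩
  have hpos := hX.pos n
  have hlt := hX.lt n
  have heq := hX.eq n
  have b0 := abs_lt.1 (hX.abs_lift_lt n)
  have b1 := abs_lt.1 (hX.abs_lift_lt (n + 1))
  have b2 := abs_lt.1 (hX.abs_lift_lt (n - 1))
  rw [hu] at hpos hlt
  rw [ha] at heq
  -- The constant is 2000 from the scaling, 1 from the rounding and 2 from the lifts.
  have hcos : |c - Real.cos (2 * Real.pi * X n)| ≤ 2003 / κ := by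
    rw [le_div_iff₀ hk]
    calc _ = |(c - Real.cos (2 * Real.pi * X n)) * κ| := by rw [abs_mul, abs_of_pos hk]
      _ ≤ 2003 := by
        rw [abs_le] at *
        constructor <;> nlinarith
  have h8 := sq_sub_le_abs_cos_sub_cos (x := ((s : ℤ) : ℝ) * x) (y := ((s : ℤ) : ℝ) * X n)
    (hs ▸ abs_nonneg x) (hs ▸ hx) hpos.le hlt.le
  rw [show 2 * Real.pi * (((s : ℤ) : ℝ) * x) = ((s : ℤ) : ℝ) * (2 * Real.pi * x) by ring,
    show 2 * Real.pi * (((s : ℤ) : ℝ) * X n) = ((s : ℤ) : ℝ) * (2 * Real.pi * X n) by ring,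
    cos_sign_mul, cos_sign_mul, ← mul_sub, ← sq_abs, abs_sign_mul] at h8
  refine (sq_le_sq₀ (abs_nonneg _) (by positivity)).1 ?_
  rw [div_pow, Real.sq_sqrt hk.le]
  -- The density constant 16 comes from `2003 ≤ 8 · 16²`.
  have : (2003 : ℝ) / κ ≤ 8 * (16 ^ 2 / κ) := by
    rw [← mul_div_assoc]
    gcongr
    norm_num
  linarith

/-- The sine term is at least `2πκ · 44/√κ = 88π√κ`, and the surplus `8π√κ` absorbs the summand 2.
The constant 2000 in `Admissible` is large enough to leave this room above `80π`. -/
theorem slope_lower_bound {κ s : ℝ} (hκ : 3000 ≤ κ) (hs : 44 / Real.sqrt κ ≤ |s|) :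
    80 * Real.pi * Real.sqrt κ ≤ |2 - 2 * Real.pi * κ * s| := by
  have hk : 0 < κ := by linarith
  have hsk : 1 ≤ Real.sqrt κ := Real.le_sqrt_of_sq_le (by linarith)
  have pi3 := Real.pi_gt_three
  have h1 : 88 * Real.pi * Real.sqrt κ ≤ |2 * Real.pi * κ * s| := by
    rw [abs_mul, abs_of_pos (by positivity : 0 < 2 * Real.pi * κ)]
    calc 88 * Real.pi * Real.sqrt κ = 2 * Real.pi * κ * (44 / Real.sqrt κ) := by
          nth_rewrite 2 [← Real.sq_sqrt hk.le]
          field_simp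
          ring
      _ ≤ _ := by gcongr
  have h2 : |2 * Real.pi * κ * s| ≤ |2 - 2 * Real.pi * κ * s| + 2 := by
    have := abs_sub_abs_le_abs_sub (2 * Real.pi * κ * s) 2
    rw [abs_sub_comm, abs_of_pos (by norm_num : (0 : ℝ) < 2)] at this
    linarith
  nlinarith

theorem four_le_slope {κ s : ℝ} (hκ : 3000 ≤ κ) (hs : 44 / Real.sqrt κ ≤ |s|) :
    4 ≤ |2 - 2 * Real.pi * κ * s| := by
  have hsk : 1 ≤ Real.sqrt κ := Real.le_sqrt_of_sq_le (by linarith)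
  have pi3 := Real.pi_gt_three
  refine le_trans ?_ (slope_lower_bound hκ hs)
  nlinarith

/-! ### Smooth dependence on the parameter -/

theorem abs_taylor_le {f f' : ℝ → ℝ} (hd : ∀ x, HasDerivAt f (f' x) x)
    (hl : ∀ x y, |f' x - f' y| ≤ |x - y|) (x y : ℝ) :
    |f y - f x - f' x * (y - x)| ≤ |y - x| ^ 2 := by
  have h := Convex.norm_image_sub_le_of_norm_hasDerivWithin_le (s := uIcc x y)
    (f := fun t => f t - f' x * t) (f' := fun t => f' t - f' x) (C := |y - x|)
    (fun t _ => by
      have h1 : HasDerivAt (fun t => f' x * t) (f' x) t := by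
        simpa using (hasDerivAt_id t).const_mul (f' x)
      exact ((hd t).sub h1).hasDerivWithinAt)
    (fun t ht => (hl _ _).trans (abs_sub_left_of_mem_uIcc ht)) (convex_uIcc x y)
    left_mem_uIcc right_mem_uIcc
  rw [pow_two]
  simp only [Real.norm_eq_abs] at h
  convert h using 2
  ring

/-- The superposition operator of a bounded function on bounded sequences. -/
noncomputable def superpose (f : ℝ → ℝ) {C : ℝ} (hf : ∀ x, |f x| ≤ C) (x : ℤ →ᵇ ℝ) : ℤ →ᵇ ℝ :=
  BoundedContinuousFunction.ofNormedAddCommGroupDiscrete (fun n => f (x n)) C (fun n => hf (x n))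

/-- The quadratic Taylor remainder is bounded uniformly over the entries, hence in the sup norm. -/
theorem hasFDerivAt_superpose {f f' : ℝ → ℝ} {C C' : ℝ} (hf : ∀ x, |f x| ≤ C)
    (hf' : ∀ x, |f' x| ≤ C') (hd : ∀ x, HasDerivAt f (f' x) x)
    (hl : ∀ x y, |f' x - f' y| ≤ |x - y|) (x : ℤ →ᵇ ℝ) :
    HasFDerivAt (superpose f hf)
      (ContinuousLinearMap.mul ℝ (ℤ →ᵇ ℝ) (superpose f' hf' x)) x := by
  refine HasFDerivAt.of_isLittleO (Asymptotics.IsBigO.trans_isLittleO (g := fun y => ‖y - x‖ ^ 2)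
    (Asymptotics.IsBigO.of_bound 1 (Eventually.of_forall fun y => ?_))
    (Asymptotics.isLittleO_pow_sub_sub x (by norm_num)))
  rw [one_mul, BoundedContinuousFunction.norm_le (norm_nonneg _)]
  intro n
  refine (abs_taylor_le hd hl (x n) (y n)).trans ?_
  rw [norm_pow, norm_norm]
  gcongr
  exact BoundedContinuousFunction.norm_coe_le_norm (y - x) n

theorem abs_sin_sub_sin_le (x y : ℝ) : |Real.sin x - Real.sin y| ≤ |x - y| := by
  have := Convex.norm_image_sub_le_of_norm_hasDerivWithin_le (s := univ) (f := Real.sin)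
    (f' := Real.cos) (C := 1) (fun t _ => (Real.hasDerivAt_sin t).hasDerivWithinAt)
    (fun t _ => Real.abs_cos_le_one t) convex_univ (mem_univ y) (mem_univ x)
  simpa using this

theorem abs_cos_sub_cos_le (x y : ℝ) : |Real.cos x - Real.cos y| ≤ |x - y| := by
  have := abs_sin_sub_sin_le (Real.pi / 2 - x) (Real.pi / 2 - y)
  rw [Real.sin_pi_div_two_sub, Real.sin_pi_div_two_sub] at this
  rwa [sub_sub_sub_cancel_left, abs_sub_comm y x] at this

theorem hasFDerivAt_superpose_cos (x : ℤ →ᵇ ℝ) :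
    HasFDerivAt (superpose Real.cos Real.abs_cos_le_one)
      (-ContinuousLinearMap.mul ℝ (ℤ →ᵇ ℝ) (superpose Real.sin Real.abs_sin_le_one x)) x := by
  have h := hasFDerivAt_superpose Real.abs_cos_le_one (f' := fun x => -Real.sin x) (C' := 1)
    (fun x => by rw [abs_neg]; exact Real.abs_sin_le_one x) Real.hasDerivAt_cos
    (fun x y => by
      rw [neg_sub_neg, abs_sub_comm]
      exact abs_sin_sub_sin_le x y) x
  rw [← map_neg]
  exact h

/-- Up to sign, each superposition operator is the derivative of the other followed by
multiplication, so the two must be treated in one induction. -/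
theorem contDiff_superpose_cos_sin (n : ℕ) :
    ContDiff ℝ n (superpose Real.cos Real.abs_cos_le_one) ∧
      ContDiff ℝ n (superpose Real.sin Real.abs_sin_le_one) := by
  induction n with
  | zero =>
    rw [Nat.cast_zero, contDiff_zero, contDiff_zero]
    exact ⟨continuous_iff_continuousAt.2 fun x => (hasFDerivAt_superpose_cos x).continuousAt,
      continuous_iff_continuousAt.2 fun x => (hasFDerivAt_superpose Real.abs_sin_le_one
        Real.abs_cos_le_one Real.hasDerivAt_sin abs_cos_sub_cos_le x).continuousAt⟩
  | succ n ih =>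
    push_cast
    rw [contDiff_succ_iff_hasFDerivAt, contDiff_succ_iff_hasFDerivAt]
    have hM : ContDiff ℝ n (ContinuousLinearMap.mul ℝ (ℤ →ᵇ ℝ)) := ContinuousLinearMap.contDiff _
    exact ⟨⟨fun x => -ContinuousLinearMap.mul ℝ (ℤ →ᵇ ℝ)
          (superpose Real.sin Real.abs_sin_le_one x), (hM.comp ih.2).neg,
        hasFDerivAt_superpose_cos⟩,
      ⟨fun x => ContinuousLinearMap.mul ℝ (ℤ →ᵇ ℝ)
          (superpose Real.cos Real.abs_cos_le_one x), hM.comp ih.1,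
        hasFDerivAt_superpose Real.abs_sin_le_one Real.abs_cos_le_one Real.hasDerivAt_sin
          abs_cos_sub_cos_le⟩⟩

/-- Translation of bounded sequences. -/
noncomputable def translate (k : ℤ) : (ℤ →ᵇ ℝ) →L[ℝ] (ℤ →ᵇ ℝ) :=
  BoundedContinuousFunction.compContinuousCLM ℝ ℝ ⟨fun n => n + k, continuous_of_discreteTopology⟩

/-- The operator whose level sets are the orbits of the standard maps. -/
noncomputable def orbitOperator (q : ℝ × (ℤ →ᵇ ℝ)) : ℤ →ᵇ ℝ :=
  (2 : ℝ) • q.2 + q.1 • superpose Real.cos Real.abs_cos_le_one ((2 * Real.pi) • q.2) -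
    (translate 1 + translate (-1)) q.2

theorem orbitOperator_apply (κ : ℝ) (x : ℤ →ᵇ ℝ) (n : ℤ) :
    orbitOperator (κ, x) n =
      2 * x n + κ * Real.cos (2 * Real.pi * x n) - (x (n + 1) + x (n - 1)) := rfl

theorem contDiff_orbitOperator : ContDiff ℝ ∞ orbitOperator := by
  have hc : ContDiff ℝ ∞ (superpose Real.cos Real.abs_cos_le_one) :=
    contDiff_infty.2 fun n => (contDiff_superpose_cos_sin n).1
  refine ((contDiff_snd.const_smul _).add (contDiff_fst.smul
    (hc.comp (contDiff_snd.const_smul _)))).sub (ContinuousLinearMap.contDiff _ |>.comp contDiff_snd)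

theorem hasFDerivAt_orbitOperator_right (κ : ℝ) (x : ℤ →ᵇ ℝ) {b : ℤ →ᵇ ℝ}
    (hb : ∀ n, b n = 2 - 2 * Real.pi * κ * Real.sin (2 * Real.pi * x n)) :
    HasFDerivAt (fun y => orbitOperator (κ, y))
      (ContinuousLinearMap.mul ℝ (ℤ →ᵇ ℝ) b - (translate 1 + translate (-1))) x := by
  have h1 : HasFDerivAt (fun y : ℤ →ᵇ ℝ => (2 * Real.pi) • y)
      ((2 * Real.pi) • ContinuousLinearMap.id ℝ (ℤ →ᵇ ℝ)) x :=
    ContinuousLinearMap.hasFDerivAt ((2 * Real.pi) • ContinuousLinearMap.id ℝ (ℤ →ᵇ ℝ))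
  have h2 := ((hasFDerivAt_superpose_cos ((2 * Real.pi) • x)).comp x h1).const_smul κ
  have h3 : HasFDerivAt (fun y : ℤ →ᵇ ℝ => (2 : ℝ) • y)
      ((2 : ℝ) • ContinuousLinearMap.id ℝ (ℤ →ᵇ ℝ)) x :=
    ContinuousLinearMap.hasFDerivAt ((2 : ℝ) • ContinuousLinearMap.id ℝ (ℤ →ᵇ ℝ))
  refine ((h3.add h2).sub (translate 1 + translate (-1)).hasFDerivAt).congr_fderiv ?_
  congr 1
  ext h n
  change 2 * h n + κ * -(Real.sin (2 * Real.pi * x n) * (2 * Real.pi * h n)) = b n * h n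
  rw [hb]
  ring

theorem norm_translate_le (k : ℤ) : ‖translate k‖ ≤ 1 :=
  BoundedContinuousFunction.norm_compContinuousCLM_le_one _

theorem isUnit_one_sub_of_opNorm_lt_one {E : Type*} [NormedAddCommGroup E] [NormedSpace ℝ E]
    [CompleteSpace E] {T : E →L[ℝ] E} (h : ‖T‖ < 1) : IsUnit (1 - T) :=
  isUnit_one_sub_of_norm_lt_one h

/-- Multiplication by `b` has an inverse of norm at most 1/4, and the two translations have norm at
most 2 together, so a Neumann series with ratio 1/2 applies. -/
theorem isUnit_mul_sub_translate {b : ℤ →ᵇ ℝ} (hb : ∀ n, 4 ≤ |b n|) :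
    IsUnit (ContinuousLinearMap.mul ℝ (ℤ →ᵇ ℝ) b - (translate 1 + translate (-1))) := by
  let c : ℤ →ᵇ ℝ := BoundedContinuousFunction.ofNormedAddCommGroupDiscrete (fun n => (b n)⁻¹)
    (1 / 4) (fun n => by
      rw [norm_inv, one_div]
      exact inv_anti₀ (by norm_num) (hb n))
  have hbc : b * c = 1 := by
    ext n
    have : b n ≠ 0 := fun h => by have := hb n; rw [h, abs_zero] at this; linarith
    exact mul_inv_cancel₀ this
  have hc : ‖c‖ ≤ 1 / 4 := BoundedContinuousFunction.norm_ofNormedAddCommGroup_le _ (by norm_num) _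
  set M := ContinuousLinearMap.mul ℝ (ℤ →ᵇ ℝ)
  have hM : M b * M c = 1 := by
    ext1 x
    change b * (c * x) = x
    rw [← mul_assoc, hbc, one_mul]
  have hM' : M c * M b = 1 := by
    ext1 x
    change c * (b * x) = x
    rw [← mul_assoc, mul_comm c b, hbc, one_mul]
  have hU : IsUnit (M b) := ⟨⟨M b, M c, hM, hM'⟩, rfl⟩
  have e : M b - (translate 1 + translate (-1)) =
      M b * (1 - M c * (translate 1 + translate (-1))) := by
    rw [mul_sub, ← mul_assoc, hM, one_mul, mul_one]
  rw [e]
  suffices h : ‖M c * (translate 1 + translate (-1))‖ < 1 from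
    hU.mul (isUnit_one_sub_of_opNorm_lt_one h)
  have hMc : ‖M c‖ ≤ 1 / 4 := (ContinuousLinearMap.opNorm_mul_apply_le ℝ _ c).trans hc
  have hT : ‖translate 1 + translate (-1)‖ ≤ 2 :=
    (norm_add_le (translate 1) (translate (-1))).trans
      (by linarith [norm_translate_le 1, norm_translate_le (-1)])
  calc _ ≤ ‖M c‖ * ‖translate 1 + translate (-1)‖ := norm_mul_le _ _
    _ ≤ 1 / 4 * 2 := by gcongr
    _ < 1 := by norm_num

/-- Near a coded orbit, the orbits with the same code depend smoothly on the parameter. -/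
theorem IsCodedOrbit.exists_smooth_continuation {κ : ℝ} (hκ : 3000 ≤ κ) {u : ℤ → ℤˣ} {a : ℤ → ℤ}
    (ha : Admissible κ a) {X : ℤ → ℝ} (hX : IsCodedOrbit κ u a X) :
    ∃ ψ : ℝ → ℤ → ℝ, (∀ n, ContDiffAt ℝ ∞ (fun t => ψ t n) κ) ∧ ψ κ = X ∧
      ∀ᶠ t in 𝓝 κ, IsCodedOrbit t u a (ψ t) := by
  let x : ℤ →ᵇ ℝ := BoundedContinuousFunction.ofNormedAddCommGroupDiscrete X (1 / 2)
    (fun n => (hX.abs_lift_lt n).le)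
  -- The diagonal part of the partial derivative of `orbitOperator` in the sequence.
  let b : ℤ →ᵇ ℝ := (2 : ℝ) • 1 - (2 * Real.pi * κ) •
    superpose Real.sin Real.abs_sin_le_one ((2 * Real.pi) • x)
  have hbn : ∀ n, b n = 2 - 2 * Real.pi * κ * Real.sin (2 * Real.pi * x n) := by
    intro n
    change (2 : ℝ) * 1 - 2 * Real.pi * κ * Real.sin (2 * Real.pi * x n) = _
    rw [mul_one]
  have hb4 : ∀ n, 4 ≤ |b n| := by
    intro n
    rw [hbn]
    exact four_le_slope hκ (le_abs_sin_of_abs_cos_le hκ (hX.abs_cos_lift_le ha hκ n))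
  have cdf : ContDiffAt ℝ ∞ orbitOperator (κ, x) := contDiff_orbitOperator.contDiffAt
  have e : fderiv ℝ orbitOperator (κ, x) ∘L .inr ℝ ℝ (ℤ →ᵇ ℝ) =
      ContinuousLinearMap.mul ℝ (ℤ →ᵇ ℝ) b - (translate 1 + translate (-1)) := by
    have h1 : HasFDerivAt (fun y => orbitOperator (κ, y))
        (fderiv ℝ orbitOperator (κ, x) ∘L .inr ℝ ℝ (ℤ →ᵇ ℝ)) x :=
      ((cdf.differentiableAt (by simp)).hasFDerivAt).comp x (hasFDerivAt_prodMk_right κ x)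
    exact h1.unique (hasFDerivAt_orbitOperator_right κ x hbn)
  have if₂ : (fderiv ℝ orbitOperator (κ, x) ∘L .inr ℝ ℝ (ℤ →ᵇ ℝ)).IsInvertible := by
    rw [e]
    obtain ⟨U, hU⟩ := isUnit_mul_sub_translate hb4
    exact ⟨ContinuousLinearEquiv.unitsEquiv ℝ _ U, hU⟩
  have h0 : cdf.implicitFunction (by simp) if₂ κ = x := cdf.implicitFunction_apply_self (by simp) if₂
  have hsm : ContDiffAt ℝ ∞ (cdf.implicitFunction (by simp) if₂) κ :=
    cdf.contDiffAt_implicitFunction (by simp) if₂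
  have hev := cdf.eventually_apply_implicitFunction (by simp) if₂
  set ψ := cdf.implicitFunction (by simp) if₂
  refine ⟨fun t => ψ t, fun n => ?_, by simp only [h0]; rfl, ?_⟩
  · exact (BoundedContinuousFunction.evalCLM ℝ n).contDiff.contDiffAt.comp κ hsm
  have hsk : 0 < 1 / Real.sqrt κ := one_div_pos.2 (Real.sqrt_pos.2 (by linarith))
  -- Closeness in the sup norm, within the gap of `X`, preserves the signs and the bound 1/2 for all
  -- `n` at once.
  have hclose : ∀ᶠ t in 𝓝 κ, dist (ψ t) (ψ κ) < 1 / Real.sqrt κ :=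
    hsm.continuousAt (Metric.ball_mem_nhds _ hsk)
  filter_upwards [hev, hclose] with t ht hct
  rw [h0] at hct
  have hd : ∀ n, |((u n : ℤ) : ℝ) * ψ t n - ((u n : ℤ) : ℝ) * X n| < 1 / Real.sqrt κ := by
    intro n
    rw [← mul_sub, abs_sign_mul]
    exact lt_of_le_of_lt (BoundedContinuousFunction.dist_coe_le_dist (f := ψ t) (g := x) n) hct
  have hgap := fun n => gap_of_abs_cos_le hκ (hX.abs_lift_lt n).le (hX.abs_cos_lift_le ha hκ n)
  refine ⟨fun n => ?_, fun n => ?_, fun n => ?_⟩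
  · have h1 := hgap n
    rw [hX.abs_lift_eq n] at h1
    have h2 := _root_.abs_lt.1 (hd n)
    linarith
  · have h1 := hgap n
    rw [hX.abs_lift_eq n] at h1
    have h2 := _root_.abs_lt.1 (hd n)
    linarith
  -- The implicit function stays on the level set of `orbitOperator (κ, x)`, whose entries are the
  -- integers `a n`.
  · have h1 := DFunLike.congr_fun ht n
    rw [orbitOperator_apply, orbitOperator_apply] at h1
    have h2 := hX.eq n
    change _ = 2 * X n + κ * Real.cos (2 * Real.pi * X n) - (X (n + 1) + X (n - 1)) at h1
    linarith

/-! ### The standard map on coded orbits -/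

theorem phiDot_coe (x : ℝ) : phiDot (x : UnitAddCircle) = Real.cos (2 * Real.pi * x) := by
  rw [phiDot, Function.Periodic.lift_coe, deriv_phi]

theorem phiDDot_coe (x : ℝ) :
    phiDDot (x : UnitAddCircle) = -(2 * Real.pi) * Real.sin (2 * Real.pi * x) := by
  rw [phiDDot, Function.Periodic.lift_coe, deriv_deriv_phi]

theorem continuous_phiDot : Continuous phiDot := by
  have h : Continuous (deriv phi) := by
    rw [deriv_phi]
    fun_prop
  exact continuous_coinduced_dom.2 h

theorem standardMap_proj (κ x y : ℝ) :
    standardMap κ (proj (x, y)) = proj (y, -x + 2 * y + κ * Real.cos (2 * Real.pi * y)) := by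
  refine Prod.ext rfl ?_
  change -(x : UnitAddCircle) + (2 : ℕ) • (y : UnitAddCircle) +
    ((κ * phiDot (y : UnitAddCircle) : ℝ) : UnitAddCircle) = _
  rw [phiDot_coe]
  simp [proj, two_mul, two_nsmul]

theorem standardMap_symm_proj (κ x y : ℝ) :
    (standardMap κ).symm (proj (x, y)) =
      proj (-y + 2 * x + κ * Real.cos (2 * Real.pi * x), x) := by
  rw [Equiv.symm_apply_eq, standardMap_proj]
  congr 2
  ring

theorem continuous_standardMap (κ : ℝ) : Continuous (standardMap κ) := by
  have h := continuous_phiDot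
  change Continuous fun p : Torus =>
    ((p.2, -p.1 + (2 : ℕ) • p.2 + ((κ * phiDot p.2 : ℝ) : UnitAddCircle)) : Torus)
  have hc : Continuous fun x : ℝ => (x : UnitAddCircle) := AddCircle.continuous_mk' 1
  have h2 : Continuous fun p : Torus => ((κ * phiDot p.2 : ℝ) : UnitAddCircle) :=
    hc.comp (by fun_prop)
  fun_prop

theorem continuous_standardMap_symm (κ : ℝ) : Continuous (standardMap κ).symm := by
  have h := continuous_phiDot
  change Continuous fun p : Torus =>
    ((-p.2 + (2 : ℕ) • p.1 + ((κ * phiDot p.1 : ℝ) : UnitAddCircle), p.1) : Torus)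
  have hc : Continuous fun x : ℝ => (x : UnitAddCircle) := AddCircle.continuous_mk' 1
  have h2 : Continuous fun p : Torus => ((κ * phiDot p.1 : ℝ) : UnitAddCircle) :=
    hc.comp (by fun_prop)
  fun_prop

theorem continuous_standardMap_zpow (κ : ℝ) (n : ℤ) : Continuous ⇑(standardMap κ ^ n) := by
  cases n with
  | ofNat n =>
    rw [Int.ofNat_eq_natCast, zpow_natCast, Equiv.Perm.coe_pow]
    exact (continuous_standardMap κ).iterate n
  | negSucc n =>
    rw [zpow_negSucc, ← inv_pow, Equiv.Perm.coe_pow]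
    exact (continuous_standardMap_symm κ).iterate (n + 1)

theorem eq_of_coe_eq_of_small {x y : ℝ} (h : (x : UnitAddCircle) = y) (hx : |x| < 1 / 2)
    (hy : |y| < 1 / 2) : x = y := by
  have := eq_of_proj_eq_of_small (v := (x, 0)) (w := (y, 0)) (by simp [proj, h])
    (by simpa [Prod.norm_def] using hx) (by simpa [Prod.norm_def] using hy)
  exact congrArg Prod.fst this

theorem coe_sub_intCast (x : ℝ) (a : ℤ) : ((x - a : ℝ) : UnitAddCircle) = x := by
  rw [AddCircle.coe_sub, sub_eq_self]
  exact (AddCircle.coe_eq_zero_iff (1 : ℝ)).2 ⟨a, by simp⟩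

theorem IsCodedOrbit.shift {κ : ℝ} {u : ℤ → ℤˣ} {a : ℤ → ℤ} {X : ℤ → ℝ}
    (h : IsCodedOrbit κ u a X) (k : ℤ) :
    IsCodedOrbit κ (fun n => u (n + k)) (fun n => a (n + k)) (fun n => X (n + k)) where
  pos n := h.pos _
  lt n := h.lt _
  eq n := by
    have := h.eq (n + k)
    rw [show n + 1 + k = n + k + 1 by ring, show n - 1 + k = n + k - 1 by ring]
    exact this

theorem IsCodedOrbit.map_proj {κ : ℝ} {u : ℤ → ℤˣ} {a : ℤ → ℤ} {X : ℤ → ℝ}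
    (h : IsCodedOrbit κ u a X) (n : ℤ) :
    standardMap κ (proj (X n, X (n + 1))) = proj (X (n + 1), X (n + 1 + 1)) := by
  rw [standardMap_proj]
  refine Prod.ext rfl ?_
  have h1 := h.eq (n + 1)
  rw [add_sub_cancel_right] at h1
  change ((_ : ℝ) : UnitAddCircle) = ((X (n + 1 + 1) : ℝ) : UnitAddCircle)
  rw [← coe_sub_intCast _ (a (n + 1))]
  congr 1
  linarith

theorem IsCodedOrbit.zpow_proj {κ : ℝ} {u : ℤ → ℤˣ} {a : ℤ → ℤ} {X : ℤ → ℝ}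
    (h : IsCodedOrbit κ u a X) (n : ℤ) :
    (standardMap κ ^ n) (proj (X 0, X 1)) = proj (X n, X (n + 1)) := by
  induction n with
  | zero => simp
  | succ n ih =>
    rw [add_comm (n : ℤ) 1, zpow_one_add, Equiv.Perm.mul_apply, ih, h.map_proj, add_comm 1 (n : ℤ)]
  | pred n ih =>
    have h1 := h.map_proj (-n - 1)
    rw [sub_add_cancel, ← ih] at h1
    rw [sub_add_cancel, show (-n - 1 : ℤ) = -1 + -n by ring, zpow_add, Equiv.Perm.mul_apply,
      zpow_neg_one, Equiv.Perm.inv_eq_iff_eq, ← h1]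
    congr 4
    ring

/-- The initial point determines the orbit on the torus, and each class has at most one lift in
`(-1/2, 1/2)`. -/
theorem IsCodedOrbit.lift_unique {κ : ℝ} {u u' : ℤ → ℤˣ} {a a' : ℤ → ℤ} {X X' : ℤ → ℝ}
    (h : IsCodedOrbit κ u a X) (h' : IsCodedOrbit κ u' a' X')
    (hp : proj (X 0, X 1) = proj (X' 0, X' 1)) : X = X' := by
  funext n
  have h1 := h.zpow_proj n
  rw [hp, h'.zpow_proj n] at h1
  exact (eq_of_coe_eq_of_small (congrArg Prod.fst h1) (h'.abs_lift_lt n) (h.abs_lift_lt n)).symm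

theorem IsCodedOrbit.code_unique {κ : ℝ} {u u' : ℤ → ℤˣ} {a a' : ℤ → ℤ} {X X' : ℤ → ℝ}
    (h : IsCodedOrbit κ u a X) (h' : IsCodedOrbit κ u' a' X')
    (hp : proj (X 0, X 1) = proj (X' 0, X' 1)) : u = u' ∧ a = a' := by
  obtain rfl := h.lift_unique h' hp
  constructor
  · funext n
    have h1 := h.pos n
    have h2 := h'.pos n
    rcases Int.units_eq_one_or (u n) with e | e <;> rcases Int.units_eq_one_or (u' n) with e' | e'
      <;> rw [e] at h1 ⊢ <;> rw [e'] at h2 ⊢ <;> simp at h1 h2 <;> linarith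
  · funext n
    have h1 := h.eq n
    have h2 := h'.eq n
    have : (a n : ℝ) = a' n := by linarith
    exact_mod_cast this

/-! ### The coded set: compactness, local maximality, density -/

/-- The points of the coded orbits. -/
def codedSet (κ : ℝ) : Set Torus :=
  {p | ∃ u a X, Admissible κ a ∧ IsCodedOrbit κ u a X ∧ p = proj (X 0, X 1)}

theorem zpow_mem_codedSet {κ : ℝ} {p : Torus} (hp : p ∈ codedSet κ) (k : ℤ) :
    (standardMap κ ^ k) p ∈ codedSet κ := by
  obtain ⟨u, a, X, ha, hX, rfl⟩ := hp
  refine ⟨_, _, _, fun n => ha (n + k), hX.shift k, ?_⟩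
  rw [hX.zpow_proj k]
  simp [add_comm]

/-- The pairs of consecutive lifts in `D` such that the next point of the orbit has a lift in `D`,
up to an allowed translation. -/
def windowLift (κ : ℝ) (D : Set ℝ) : Set Plane :=
  {v | v.1 ∈ D ∧ v.2 ∈ D ∧ ∃ a : ℤ, |(a : ℝ)| ≤ κ - 2000 ∧
    -v.1 + 2 * v.2 + κ * Real.cos (2 * Real.pi * v.2) - a ∈ D}

theorem windowLift_mono {κ : ℝ} {D D' : Set ℝ} (h : D ⊆ D') : windowLift κ D ⊆ windowLift κ D' :=
  fun _ ⟨h1, h2, a, ha, h3⟩ => ⟨h h1, h h2, a, ha, h h3⟩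

theorem windowLift_eq (κ : ℝ) (D : Set ℝ) :
    windowLift κ D = ⋃ a ∈ {a : ℤ | |(a : ℝ)| ≤ κ - 2000}, {v : Plane | v.1 ∈ D ∧ v.2 ∈ D ∧
      -v.1 + 2 * v.2 + κ * Real.cos (2 * Real.pi * v.2) - a ∈ D} := by
  ext v
  simp only [windowLift, mem_ofPred_eq, mem_iUnion, exists_prop]
  tauto

theorem isOpen_windowLift (κ : ℝ) {D : Set ℝ} (hD : IsOpen D) : IsOpen (windowLift κ D) := by
  rw [windowLift_eq]
  refine isOpen_biUnion fun a _ => ?_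
  exact (hD.preimage continuous_fst).inter
    ((hD.preimage continuous_snd).inter (hD.preimage (by fun_prop)))

theorem isCompact_windowLift (κ : ℝ) {D : Set ℝ} (hD : IsCompact D) :
    IsCompact (windowLift κ D) := by
  rw [windowLift_eq]
  -- Only finitely many integers are allowed translations.
  refine Set.Finite.isCompact_biUnion ?_ fun a _ => ?_
  · refine (Set.finite_Icc (-⌈κ - 2000⌉) ⌈κ - 2000⌉).subset fun a ha => ?_
    have h1 := abs_le.1 (mem_ofPred_eq ▸ ha)
    have h2 := Int.le_ceil (κ - 2000)
    refine ⟨?_, ?_⟩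
    · have : ((-⌈κ - 2000⌉ : ℤ) : ℝ) ≤ a := by push_cast; linarith
      exact_mod_cast this
    · have : (a : ℝ) ≤ ⌈κ - 2000⌉ := by linarith
      exact_mod_cast this
  · refine (hD.prod hD).of_isClosed_subset ?_ fun v hv => ⟨hv.1, hv.2.1⟩
    exact (hD.isClosed.preimage continuous_fst).inter
      ((hD.isClosed.preimage continuous_snd).inter (hD.isClosed.preimage (by fun_prop)))

theorem continuous_proj : Continuous proj := by
  have hc : Continuous fun x : ℝ => (x : UnitAddCircle) := AddCircle.continuous_mk' 1
  exact (hc.comp continuous_fst).prodMk (hc.comp continuous_snd)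

theorem isOpenMap_proj : IsOpenMap proj :=
  IsOpenMap.prodMap QuotientAddGroup.isOpenMap_coe QuotientAddGroup.isOpenMap_coe

/-- The lifts different from the turning points `0` and `1/2` of the cosine. -/
def openLifts : Set ℝ := {x | 0 < |x| ∧ |x| < 1 / 2}

/-- The lifts at distance at least `d` from the turning points of the cosine. -/
def compactLifts (d : ℝ) : Set ℝ := {x | d ≤ |x| ∧ |x| ≤ 1 / 2 - d}

theorem isOpen_openLifts : IsOpen openLifts :=
  (isOpen_lt continuous_const continuous_abs).inter (isOpen_lt continuous_abs continuous_const)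

theorem isCompact_compactLifts (d : ℝ) : IsCompact (compactLifts d) := by
  refine (isCompact_Icc (a := -(1 / 2 - d)) (b := 1 / 2 - d)).of_isClosed_subset
    ((isClosed_le continuous_const continuous_abs).inter
      (isClosed_le continuous_abs continuous_const)) fun x hx => abs_le.1 hx.2

theorem compactLifts_subset {d : ℝ} (hd : 0 < d) : compactLifts d ⊆ openLifts :=
  fun _ hx => ⟨hd.trans_le hx.1, hx.2.trans_lt (by linarith)⟩

theorem mem_window_of_mem_codedSet {κ : ℝ} (hκ : 3000 ≤ κ) {p : Torus} (hp : p ∈ codedSet κ) :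
    p ∈ proj '' windowLift κ (compactLifts (1 / Real.sqrt κ)) := by
  obtain ⟨u, a, X, ha, hX, rfl⟩ := hp
  have hgap : ∀ n, X n ∈ compactLifts (1 / Real.sqrt κ) := fun n =>
    gap_of_abs_cos_le hκ (hX.abs_lift_lt n).le (hX.abs_cos_lift_le ha hκ n)
  refine ⟨_, ⟨hgap 0, hgap 1, a 1, ha 1, ?_⟩, rfl⟩
  have h1 := hX.eq 1
  rw [sub_self] at h1
  convert hgap (1 + 1) using 1
  simp only
  linarith

/-- The lifts chosen separately at each time fit together, because lifts in `(-1/2, 1/2)` are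
unique. -/
theorem mem_codedSet_of_window {κ : ℝ} {p : Torus}
    (h : ∀ n : ℤ, (standardMap κ ^ n) p ∈ proj '' windowLift κ openLifts) : p ∈ codedSet κ := by
  choose v hv hvp using h
  choose h1 h2 a ha h3 using hv
  have hnext : ∀ n, (v (n + 1)).1 = (v n).2 ∧ (v (n + 1)).2 =
      -(v n).1 + 2 * (v n).2 + κ * Real.cos (2 * Real.pi * (v n).2) - a n := by
    intro n
    have e : proj (v (n + 1)) = standardMap κ (proj ((v n).1, (v n).2)) := by
      rw [hvp (n + 1), add_comm, zpow_one_add, Equiv.Perm.mul_apply, ← hvp n]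
    rw [standardMap_proj] at e
    refine ⟨eq_of_coe_eq_of_small (congrArg Prod.fst e) (h1 _).2 (h2 _).2,
      eq_of_coe_eq_of_small ((congrArg Prod.snd e).trans ?_) (h2 _).2 (h3 _).2⟩
    exact (coe_sub_intCast _ _).symm
  have hsign : ∀ n, ∃ s : ℤˣ, ((s : ℤ) : ℝ) * (v n).1 = |(v n).1| := by
    intro n
    rcases le_total 0 (v n).1 with h | h
    · exact ⟨1, by simp [abs_of_nonneg h]⟩
    · exact ⟨-1, by simp [abs_of_nonpos h]⟩
  choose s hs using hsign
  -- The translation found in the window at time `n` belongs to the second lift, which is the one at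
  -- time `n + 1`; hence the shift.
  refine ⟨s, fun n => a (n - 1), fun n => (v n).1, fun n => ha _, ⟨fun n => ?_, fun n => ?_,
    fun n => ?_⟩, ?_⟩
  · rw [hs]
    exact (h1 n).1
  · rw [hs]
    exact (h1 n).2
  · have e1 := hnext (n - 1)
    have e2 := hnext n
    rw [sub_add_cancel] at e1
    rw [← e1.1] at e1
    linarith [e1.2, e2.1]
  · have e := (hnext 0).1
    rw [zero_add] at e
    change p = proj ((v 0).1, (v 1).1)
    rw [e]
    exact (hvp 0).symm

/-- Coded orbits stay in the compact window and orbits in the larger open window are coded, so the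
coded set is an intersection of closed preimages. -/
theorem isCompact_codedSet {κ : ℝ} (hκ : 3000 ≤ κ) : IsCompact (codedSet κ) := by
  have hd : 0 < 1 / Real.sqrt κ := one_div_pos.2 (Real.sqrt_pos.2 (by linarith))
  set V := proj '' windowLift κ (compactLifts (1 / Real.sqrt κ))
  have hV : IsClosed V :=
    ((isCompact_windowLift κ (isCompact_compactLifts _)).image continuous_proj).isClosed
  have e : codedSet κ = ⋂ n : ℤ, ⇑(standardMap κ ^ n) ⁻¹' V := by
    ext p
    rw [mem_iInter]
    refine ⟨fun hp n => mem_window_of_mem_codedSet hκ (zpow_mem_codedSet hp n), fun h =>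
      mem_codedSet_of_window fun n => ?_⟩
    exact image_mono (windowLift_mono (compactLifts_subset hd)) (h n)
  rw [e]
  exact (isClosed_iInter fun n => hV.preimage (continuous_standardMap_zpow κ n)).isCompact

theorem codedSet_locallyMaximal {κ : ℝ} (hκ : 3000 ≤ κ) :
    ∃ U : Set Torus, IsOpen U ∧ codedSet κ ⊆ U ∧
      codedSet κ = ⋂ n : ℤ, (standardMap κ ^ n) '' U := by
  have hd : 0 < 1 / Real.sqrt κ := one_div_pos.2 (Real.sqrt_pos.2 (by linarith))
  have hsub : codedSet κ ⊆ proj '' windowLift κ openLifts := fun p hp =>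
    image_mono (windowLift_mono (compactLifts_subset hd)) (mem_window_of_mem_codedSet hκ hp)
  refine ⟨_, isOpenMap_proj _ (isOpen_windowLift κ isOpen_openLifts), hsub, ?_⟩
  ext p
  rw [mem_iInter]
  have hiff : ∀ (n : ℤ) (U : Set Torus),
      p ∈ (standardMap κ ^ n) '' U ↔ (standardMap κ ^ (-n)) p ∈ U := by
    intro n U
    rw [Equiv.image_eq_preimage_symm, mem_preimage, zpow_neg]
    rfl
  refine ⟨fun hp n => (hiff _ _).2 (hsub (zpow_mem_codedSet hp _)), fun h =>
    mem_codedSet_of_window fun n => ?_⟩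
  have := (hiff (-n) _).1 (h (-n))
  rwa [neg_neg] at this

theorem image_codedSet (κ : ℝ) : standardMap κ '' codedSet κ = codedSet κ := by
  refine Subset.antisymm ?_ fun p hp => ?_
  · rintro _ ⟨p, hp, rfl⟩
    simpa using zpow_mem_codedSet hp 1
  · refine ⟨(standardMap κ ^ (-1 : ℤ)) p, zpow_mem_codedSet hp _, ?_⟩
    rw [zpow_neg_one]
    exact (standardMap κ).apply_symm_apply p

theorem codedSet_subset_compl_criticalSet {κ : ℝ} (hκ : 3000 ≤ κ) :
    codedSet κ ⊆ (criticalSet κ)ᶜ := by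
  rintro _ ⟨u, a, X, ha, hX, rfl⟩
  have hk : 0 < κ := by linarith
  have h := slope_lower_bound hκ (le_abs_sin_of_abs_cos_le hκ (hX.abs_cos_lift_le ha hκ 0))
  change ¬ (|κ * (phiDDot (X 0 : UnitAddCircle) + 2 / κ)| < 80 * Real.pi * κ ^ (1 / 2 : ℝ))
  rw [phiDDot_coe, ← Real.sqrt_eq_rpow, not_lt]
  refine h.trans (le_of_eq (congrArg _ ?_))
  rw [mul_add, mul_div_cancel₀ _ hk.ne']
  ring

theorem exists_lift (x : UnitAddCircle) : ∃ y : ℝ, (y : UnitAddCircle) = x ∧ |y| ≤ 1 / 2 := by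
  obtain ⟨y, rfl⟩ := QuotientAddGroup.mk_surjective x
  exact ⟨y - round y, coe_sub_intCast _ _, abs_sub_round y⟩

theorem dist_coe_le (x y : ℝ) : dist (x : UnitAddCircle) (y : UnitAddCircle) ≤ |x - y| := by
  rw [dist_eq_norm, ← AddCircle.coe_sub]
  exact QuotientAddGroup.norm_mk_le_norm

theorem codedSet_dense {κ : ℝ} (hκ : 3000 ≤ κ) (q : Torus) :
    ∃ p ∈ codedSet κ, dist q p ≤ 16 * κ ^ (-(1 / 2) : ℝ) := by
  obtain ⟨x, hx, hx2⟩ := exists_lift q.1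
  obtain ⟨y, hy, hy2⟩ := exists_lift q.2
  obtain ⟨s, b, hb, h1⟩ := exists_symbol_near hκ hx2
  obtain ⟨s', b', hb', h2⟩ := exists_symbol_near hκ hy2
  -- Only the symbols at times 0 and 1 matter; the others are arbitrary admissible ones.
  have ha : Admissible κ fun n => if n = 0 then b else b' := by
    intro n
    dsimp only
    split_ifs <;> assumption
  obtain ⟨X, hX⟩ := exists_isCodedOrbit hκ (fun n => if n = 0 then s else s') ha
  refine ⟨_, ⟨_, _, X, ha, hX, rfl⟩, ?_⟩
  rw [Real.rpow_neg (by linarith), ← Real.sqrt_eq_rpow, ← div_eq_mul_inv, Prod.dist_eq, ← hx, ← hy]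
  exact max_le ((dist_coe_le _ _).trans (h1 _ _ X hX 0 (by simp) (by simp)))
    ((dist_coe_le _ _).trans (h2 _ _ X hX 1 (by simp) (by simp)))

/-! ### Continuation in the parameter -/

open Classical in
/-- The lifts of the orbit with a given code. -/
noncomputable def orbitLift (κ : ℝ) (u : ℤ → ℤˣ) (a : ℤ → ℤ) : ℤ → ℝ :=
  if h : ∃ X, IsCodedOrbit κ u a X then h.choose else 0

theorem isCodedOrbit_orbitLift {κ : ℝ} (hκ : 3000 ≤ κ) (u : ℤ → ℤˣ) {a : ℤ → ℤ}
    (ha : Admissible κ a) : IsCodedOrbit κ u a (orbitLift κ u a) := by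
  have h := exists_isCodedOrbit hκ u ha
  rw [orbitLift, dif_pos h]
  exact h.choose_spec

theorem IsCodedOrbit.eq_orbitLift {κ : ℝ} (hκ : 3000 ≤ κ) {u : ℤ → ℤˣ} {a : ℤ → ℤ}
    (ha : Admissible κ a) {X : ℤ → ℝ} (hX : IsCodedOrbit κ u a X) : X = orbitLift κ u a :=
  hX.unique hκ ha (isCodedOrbit_orbitLift hκ u ha)

theorem contDiffOn_orbitLift {κ : ℝ} (hκ : 3000 ≤ κ) (u : ℤ → ℤˣ) {a : ℤ → ℤ}
    (ha : Admissible κ a) (n : ℤ) :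
    ContDiffOn ℝ ∞ (fun t => orbitLift t u a n) (Ici κ) := by
  intro t ht
  have hκt : 3000 ≤ t := hκ.trans ht
  obtain ⟨ψ, hψ, hψt, hev⟩ :=
    (isCodedOrbit_orbitLift hκt u (ha.mono ht)).exists_smooth_continuation hκt (ha.mono ht)
  -- By uniqueness of coded orbits the local smooth branch agrees with `orbitLift` at nearby
  -- parameters at least `κ`, where the code is admissible.
  refine ((hψ n).contDiffWithinAt).congr_of_eventuallyEq ?_ (by simp only [hψt])
  filter_upwards [mem_nhdsWithin_of_mem_nhds hev, self_mem_nhdsWithin] with t' h1 h2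
  rw [h1.eq_orbitLift (hκ.trans h2) (ha.mono h2)]

open Classical in
/-- The continuation of the points of `codedSet κs` to the parameter `κ`: the point with the same
code. -/
noncomputable def continuation (κs κ : ℝ) (p : Torus) : Torus :=
  -- A point has at most one code, so the choice is harmless; points without a code are left fixed.
  if h : ∃ c : (ℤ → ℤˣ) × (ℤ → ℤ), ∃ X, IsCodedOrbit κs c.1 c.2 X ∧ p = proj (X 0, X 1) then
    proj (orbitLift κ h.choose.1 h.choose.2 0, orbitLift κ h.choose.1 h.choose.2 1)
  else p

theorem IsCodedOrbit.continuation_eq {κs : ℝ} (κ : ℝ) {u : ℤ → ℤˣ} {a : ℤ → ℤ}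
    {X : ℤ → ℝ} (hX : IsCodedOrbit κs u a X) :
    continuation κs κ (proj (X 0, X 1)) = proj (orbitLift κ u a 0, orbitLift κ u a 1) := by
  have h : ∃ c : (ℤ → ℤˣ) × (ℤ → ℤ), ∃ X', IsCodedOrbit κs c.1 c.2 X' ∧
      proj (X 0, X 1) = proj (X' 0, X' 1) := ⟨(u, a), X, hX, rfl⟩
  rw [continuation, dif_pos h]
  obtain ⟨X', hX', hp⟩ := h.choose_spec
  obtain ⟨e1, e2⟩ := hX.code_unique hX' hp
  rw [← e1, ← e2]

theorem continuation_self {κ : ℝ} (hκ : 3000 ≤ κ) {p : Torus} (hp : p ∈ codedSet κ) :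
    continuation κ κ p = p := by
  obtain ⟨u, a, X, ha, hX, rfl⟩ := hp
  rw [hX.continuation_eq κ, ← hX.eq_orbitLift hκ ha]

theorem smooth_continuation {κs : ℝ} (hκ : 3000 ≤ κs) {p : Torus} (hp : p ∈ codedSet κs) :
    SmoothTorusCurveOn (fun κ => continuation κs κ p) (Ici κs) := by
  obtain ⟨u, a, X, ha, hX, rfl⟩ := hp
  exact ⟨fun κ => (orbitLift κ u a 0, orbitLift κ u a 1),
    (contDiffOn_orbitLift hκ u ha 0).prodMk (contDiffOn_orbitLift hκ u ha 1),
    fun κ _ => (hX.continuation_eq κ).symm⟩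

theorem mapsTo_continuation {κs κ : ℝ} (hκ : 3000 ≤ κs) (h : κs ≤ κ) :
    MapsTo (continuation κs κ) (codedSet κs) (codedSet κ) := by
  rintro _ ⟨u, a, X, ha, hX, rfl⟩
  rw [hX.continuation_eq κ]
  exact ⟨u, a, _, ha.mono h, isCodedOrbit_orbitLift (hκ.trans h) u (ha.mono h), rfl⟩

theorem injOn_continuation {κs κ : ℝ} (hκ : 3000 ≤ κs) (h : κs ≤ κ) :
    InjOn (continuation κs κ) (codedSet κs) := by
  rintro _ ⟨u, a, X, ha, hX, rfl⟩ _ ⟨u', a', X', ha', hX', rfl⟩ he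
  rw [hX.continuation_eq κ, hX'.continuation_eq κ] at he
  obtain ⟨rfl, rfl⟩ := (isCodedOrbit_orbitLift (hκ.trans h) u (ha.mono h)).code_unique
    (isCodedOrbit_orbitLift (hκ.trans h) u' (ha'.mono h)) he
  rw [hX.unique hκ ha hX']

/-- Both standard maps act on codes as the shift. -/
theorem continuation_standardMap {κs κ : ℝ} (hκ : 3000 ≤ κs) (h : κs ≤ κ) {p : Torus}
    (hp : p ∈ codedSet κs) :
    continuation κs κ (standardMap κs p) = standardMap κ (continuation κs κ p) := by
  obtain ⟨u, a, X, ha, hX, rfl⟩ := hp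
  have ha1 : Admissible κs fun n => a (n + 1) := fun n => ha (n + 1)
  have hY := isCodedOrbit_orbitLift (hκ.trans h) u (ha.mono h)
  have e := (hX.shift 1).continuation_eq κ
  have e1 := hX.map_proj 0
  have e2 := hY.map_proj 0
  rw [zero_add] at e1 e2
  rw [← (hY.shift 1).eq_orbitLift (hκ.trans h) (ha1.mono h)] at e
  simp only [zero_add] at e
  rw [hX.continuation_eq κ, e1, e2, e]

/-! ### Differentials on the torus -/

theorem proj_add (v w : Plane) : proj (v + w) = proj v + proj w := by
  simp [proj]

theorem HasTorusFDerivAt.comp {f g : Torus → Torus} {L M : Plane →L[ℝ] Plane} {p : Torus}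
    (hg : HasTorusFDerivAt g M (f p)) (hf : HasTorusFDerivAt f L p) :
    HasTorusFDerivAt (g ∘ f) (M ∘L L) p := by
  obtain ⟨k, k0, hk, ek⟩ := hg
  obtain ⟨h, h0, hh, eh⟩ := hf
  refine ⟨k ∘ h, by simp [h0, k0], HasFDerivAt.comp 0 (by rwa [h0]) hh, ?_⟩
  have ht : Tendsto h (𝓝 0) (𝓝 0) := by
    have := hh.continuousAt
    rwa [ContinuousAt, h0] at this
  filter_upwards [eh, ht.eventually ek] with v h1 h2
  simp only [Function.comp_apply]
  rw [h1, h2]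

theorem hasTorusFDerivAt_id (p : Torus) : HasTorusFDerivAt id (.id ℝ Plane) p :=
  ⟨id, rfl, hasFDerivAt_id 0, Eventually.of_forall fun _ => rfl⟩

theorem HasTorusFDerivAt.of_lift {f : Torus → Torus} {F : Plane → Plane}
    (hF : ∀ v, f (proj v) = proj (F v)) {L : Plane →L[ℝ] Plane} {v : Plane}
    (h : HasFDerivAt F L v) : HasTorusFDerivAt f L (proj v) := by
  refine ⟨fun w => F (v + w) - F v, by simp, ?_, Eventually.of_forall fun w => ?_⟩
  · have h1 : HasFDerivAt F L (v + 0) := by rwa [add_zero]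
    have := (h1.comp (0 : Plane) ((hasFDerivAt_id (0 : Plane)).const_add v)).sub_const (F v)
    simpa [Function.comp_def] using this
  · rw [← proj_add, hF, hF, ← proj_add, add_sub_cancel]

/-- The differential of the standard map at a point where the generating function has second
derivative `b`. -/
noncomputable def tangentMap (b : ℝ) : Plane →L[ℝ] Plane :=
  (ContinuousLinearMap.snd ℝ ℝ ℝ).prod
    (b • ContinuousLinearMap.snd ℝ ℝ ℝ - ContinuousLinearMap.fst ℝ ℝ ℝ)

/-- The inverse of `tangentMap`. -/
noncomputable def tangentInv (b : ℝ) : Plane →L[ℝ] Plane :=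
  (b • ContinuousLinearMap.fst ℝ ℝ ℝ - ContinuousLinearMap.snd ℝ ℝ ℝ).prod
    (ContinuousLinearMap.fst ℝ ℝ ℝ)

theorem tangentMap_apply (b x y : ℝ) : tangentMap b (x, y) = (y, b * y - x) := rfl

theorem tangentInv_apply (b x y : ℝ) : tangentInv b (x, y) = (b * x - y, x) := rfl

/-- The derivative of `x ↦ 2x + κ φ'(x)`. -/
noncomputable def slope (κ x : ℝ) : ℝ := 2 - 2 * Real.pi * κ * Real.sin (2 * Real.pi * x)

theorem hasDerivAt_two_mul_add_cos (κ x : ℝ) :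
    HasDerivAt (fun x => 2 * x + κ * Real.cos (2 * Real.pi * x)) (slope κ x) x := by
  have h1 : HasDerivAt (fun x : ℝ => 2 * Real.pi * x) (2 * Real.pi) x := by
    simpa using (hasDerivAt_id x).const_mul (2 * Real.pi)
  have h2 : HasDerivAt (fun x : ℝ => 2 * x) 2 x := by
    simpa using (hasDerivAt_id x).const_mul 2
  refine (h2.add (h1.cos.const_mul κ)).congr_deriv ?_
  rw [slope]
  ring

theorem hasTorusFDerivAt_standardMap (κ x y : ℝ) :
    HasTorusFDerivAt (standardMap κ) (tangentMap (slope κ y)) (proj (x, y)) := by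
  refine HasTorusFDerivAt.of_lift
    (F := fun v => (v.2, (2 * v.2 + κ * Real.cos (2 * Real.pi * v.2)) - v.1)) (fun v => ?_) ?_
  · rw [← Prod.mk.eta (p := v), standardMap_proj]
    congr 2
    ring
  · have h1 := (hasDerivAt_two_mul_add_cos κ y).comp_hasFDerivAt (x, y)
      (hasFDerivAt_snd (𝕜 := ℝ) (p := ((x, y) : Plane)))
    exact hasFDerivAt_snd.prodMk (h1.sub hasFDerivAt_fst)

theorem hasTorusFDerivAt_standardMap_symm (κ x y : ℝ) :
    HasTorusFDerivAt (standardMap κ).symm (tangentInv (slope κ x)) (proj (x, y)) := by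
  refine HasTorusFDerivAt.of_lift
    (F := fun v => ((2 * v.1 + κ * Real.cos (2 * Real.pi * v.1)) - v.2, v.1)) (fun v => ?_) ?_
  · rw [← Prod.mk.eta (p := v), standardMap_symm_proj]
    congr 2
    ring
  · have h1 := (hasDerivAt_two_mul_add_cos κ x).comp_hasFDerivAt (x, y)
      (hasFDerivAt_fst (𝕜 := ℝ) (p := ((x, y) : Plane)))
    exact (h1.sub hasFDerivAt_snd).prodMk hasFDerivAt_fst

/-! ### Invariant directions and hyperbolicity -/

/-- The inverse slopes `r n` of the directions `(r n, 1)` invariant under `tangentMap (b n)`. -/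
def UnstableSlopes (b r : ℤ → ℝ) : Prop := ∀ n, |r n| ≤ 1 / 2 ∧ r n * (b n - r (n - 1)) = 1

/-- The slopes `q n` of the directions `(1, q n)` invariant under `tangentMap (b n)`. -/
def StableSlopes (b q : ℤ → ℝ) : Prop := ∀ n, |q n| ≤ 1 / 2 ∧ q n * (b n - q (n + 1)) = 1

theorem two_le_abs_sub {b t : ℝ} (hb : 4 ≤ |b|) (ht : |t| ≤ 1 / 2) : 2 ≤ |b - t| := by
  have := abs_sub_abs_le_abs_sub b t
  linarith

/-- The recursion `r n = (b n - r (n - 1))⁻¹` is a continued fraction. Denominators of modulus at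
least 2 give the bound 1/2 and contraction by 1/4. -/
theorem exists_unstableSlopes {b : ℤ → ℝ} (hb : ∀ n, 4 ≤ |b n|) : ∃ r, UnstableSlopes b r := by
  obtain ⟨r, hr, he⟩ := exists_fixedPoint_of_halving (B := 1 / 2) (by norm_num)
    (fun r n => (b n - r (n - 1))⁻¹)
    (fun r hr n => by
      rw [abs_inv, one_div]
      exact inv_anti₀ (by norm_num) (two_le_abs_sub (hb n) (hr _)))
    (fun r s hr hs d hd n => by
      have h1 := two_le_abs_sub (hb n) (hr (n - 1))
      have h2 := two_le_abs_sub (hb n) (hs (n - 1))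
      have h1' : b n - r (n - 1) ≠ 0 := abs_pos.1 (by linarith)
      have h2' : b n - s (n - 1) ≠ 0 := abs_pos.1 (by linarith)
      have hd0 := (abs_nonneg _).trans (hd n)
      rw [inv_sub_inv h1' h2', sub_sub_sub_cancel_left, abs_div, abs_mul,
        div_le_iff₀ (by positivity)]
      nlinarith [hd (n - 1), mul_le_mul h1 h2 (by norm_num) (by positivity)])
  refine ⟨r, fun n => ⟨hr n, ?_⟩⟩
  have h1 : b n - r (n - 1) ≠ 0 := abs_pos.1 (by linarith [two_le_abs_sub (hb n) (hr (n - 1))])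
  rw [← congrFun he n]
  exact inv_mul_cancel₀ h1

theorem UnstableSlopes.unique {b r s : ℤ → ℝ} (hr : UnstableSlopes b r)
    (hs : UnstableSlopes b s) : r = s := by
  refine eq_of_halving (D := 1) (fun n => ?_) fun d hd n => ?_
  · have h1 := abs_le.1 (hr n).1
    have h2 := abs_le.1 (hs n).1
    rw [abs_le]
    constructor <;> linarith
  · have e : r n - s n = r n * s n * (r (n - 1) - s (n - 1)) := by
      linear_combination s n * (hr n).2 - r n * (hs n).2
    have hd0 := (abs_nonneg _).trans (hd n)
    rw [e, abs_mul, abs_mul]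
    have h1 : |r n| * |s n| ≤ 1 / 2 * (1 / 2) :=
      mul_le_mul (hr n).1 (hs n).1 (abs_nonneg _) (by norm_num)
    calc |r n| * |s n| * |r (n - 1) - s (n - 1)| ≤ 1 / 2 * (1 / 2) * d :=
          mul_le_mul h1 (hd _) (abs_nonneg _) (by norm_num)
      _ ≤ d / 2 := by linarith

/-- Time reversal exchanges the two recursions, so the stable case reduces to the unstable one. -/
theorem StableSlopes.reflect {b q : ℤ → ℝ} (hq : StableSlopes b q) :
    UnstableSlopes (fun n => b (-n)) (fun n => q (-n)) := by
  intro n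
  have := hq (-n)
  rwa [show -n + 1 = -(n - 1) by ring] at this

theorem exists_stableSlopes {b : ℤ → ℝ} (hb : ∀ n, 4 ≤ |b n|) : ∃ q, StableSlopes b q := by
  obtain ⟨r, hr⟩ := exists_unstableSlopes (b := fun n => b (-n)) (fun n => hb _)
  refine ⟨fun n => r (-n), fun n => ?_⟩
  have := hr (-n)
  simp only [neg_neg] at this
  rwa [show -n - 1 = -(n + 1) by ring] at this

theorem StableSlopes.unique {b q s : ℤ → ℝ} (hq : StableSlopes b q) (hs : StableSlopes b s) :
    q = s := by
  have := hq.reflect.unique hs.reflect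
  funext n
  simpa using congrFun this (-n)

/-- The stable spaces of the standard map over the coded orbits. -/
def stableSpace (κ : ℝ) (p : Torus) : Submodule ℝ Plane :=
  Submodule.span ℝ {v | ∃ u a X q, IsCodedOrbit κ u a X ∧ p = proj (X 0, X 1) ∧
    StableSlopes (fun n => slope κ (X n)) q ∧ v = (1, q 1)}

/-- The unstable spaces of the standard map over the coded orbits. -/
def unstableSpace (κ : ℝ) (p : Torus) : Submodule ℝ Plane :=
  Submodule.span ℝ {v | ∃ u a X r, IsCodedOrbit κ u a X ∧ p = proj (X 0, X 1) ∧
    UnstableSlopes (fun n => slope κ (X n)) r ∧ v = (r 0, 1)}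

section Splitting

variable {κ : ℝ} {u : ℤ → ℤˣ} {a : ℤ → ℤ} {X q r : ℤ → ℝ}

/-- The spanning set is a single vector: the point determines its lifts, and these determine the
bounded slopes. -/
theorem stableSpace_eq (hX : IsCodedOrbit κ u a X)
    (hq : StableSlopes (fun n => slope κ (X n)) q) (n : ℤ) :
    stableSpace κ (proj (X n, X (n + 1))) = Submodule.span ℝ {(1, q (n + 1))} := by
  rw [stableSpace]
  congr 1
  have hXn := hX.shift n
  have hqn : StableSlopes (fun m => slope κ (X (m + n))) fun m => q (m + n) := by
    intro m
    have := hq (m + n)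
    rwa [show m + n + 1 = m + 1 + n by ring] at this
  have e : proj (X n, X (n + 1)) = proj (X (0 + n), X (1 + n)) := by simp [add_comm]
  refine eq_singleton_iff_unique_mem.2 ⟨⟨_, _, _, _, hXn, e, hqn, by simp [add_comm]⟩, ?_⟩
  rintro _ ⟨u', a', X', q', hX', hp, hq', rfl⟩
  obtain rfl := hXn.lift_unique hX' (e.symm.trans hp)
  rw [hq'.unique hqn, add_comm]

theorem unstableSpace_eq (hX : IsCodedOrbit κ u a X)
    (hr : UnstableSlopes (fun n => slope κ (X n)) r) (n : ℤ) :
    unstableSpace κ (proj (X n, X (n + 1))) = Submodule.span ℝ {(r n, 1)} := by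
  rw [unstableSpace]
  congr 1
  have hXn := hX.shift n
  have hrn : UnstableSlopes (fun m => slope κ (X (m + n))) fun m => r (m + n) := by
    intro m
    have := hr (m + n)
    rwa [show m + n - 1 = m - 1 + n by ring] at this
  have e : proj (X n, X (n + 1)) = proj (X (0 + n), X (1 + n)) := by simp [add_comm]
  refine eq_singleton_iff_unique_mem.2 ⟨⟨_, _, _, _, hXn, e, hrn, by simp⟩, ?_⟩
  rintro _ ⟨u', a', X', r', hX', hp, hr', rfl⟩
  obtain rfl := hXn.lift_unique hX' (e.symm.trans hp)
  rw [hr'.unique hrn]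
  change (r (0 + n), (1 : ℝ)) = _
  rw [zero_add]

theorem StableSlopes.tangentMap_apply {b : ℤ → ℝ} (hq : StableSlopes b q) (n : ℤ) :
    tangentMap (b n) (1, q n) = q n • (1, q (n + 1)) := by
  rw [StandardFamily.tangentMap_apply, Prod.smul_mk, smul_eq_mul, smul_eq_mul, mul_one]
  congr 1
  linear_combination (hq n).2

theorem UnstableSlopes.tangentInv_apply {b : ℤ → ℝ} (hr : UnstableSlopes b r) (n : ℤ) :
    tangentInv (b n) (r n, 1) = r n • (r (n - 1), 1) := by
  rw [StandardFamily.tangentInv_apply, Prod.smul_mk, smul_eq_mul, smul_eq_mul, mul_one]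
  congr 1
  linear_combination (hr n).2

theorem UnstableSlopes.tangentMap_apply {b : ℤ → ℝ} (hr : UnstableSlopes b r) (n : ℤ) :
    r n • tangentMap (b n) (r (n - 1), 1) = (r n, 1) := by
  rw [StandardFamily.tangentMap_apply, Prod.smul_mk, smul_eq_mul, smul_eq_mul, mul_one]
  congr 1
  linear_combination (hr n).2

theorem IsCodedOrbit.iterate_proj (hX : IsCodedOrbit κ u a X) (n : ℕ) :
    (standardMap κ)^[n] (proj (X 0, X 1)) = proj (X n, X (n + 1)) := by
  rw [← hX.zpow_proj, zpow_natCast, Equiv.Perm.coe_pow]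

theorem IsCodedOrbit.iterate_symm_proj (hX : IsCodedOrbit κ u a X) (n : ℕ) :
    (standardMap κ).symm^[n] (proj (X 0, X 1)) = proj (X (-n), X (-n + 1)) := by
  rw [← hX.zpow_proj, zpow_neg, zpow_natCast, ← inv_pow, Equiv.Perm.coe_pow]
  rfl

/-- By the chain rule the stable vector is multiplied by a product of `n` slopes, each of modulus at
most 1/2. -/
theorem IsCodedOrbit.hasTorusFDerivAt_iterate (hX : IsCodedOrbit κ u a X)
    (hq : StableSlopes (fun n => slope κ (X n)) q) (n : ℕ) :
    ∃ (L : Plane →L[ℝ] Plane) (c : ℝ), |c| ≤ (1 / 2) ^ n ∧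
      HasTorusFDerivAt (standardMap κ)^[n] L (proj (X 0, X 1)) ∧
      L (1, q 1) = c • (1, q (n + 1)) := by
  induction n with
  | zero => exact ⟨_, 1, by simp, hasTorusFDerivAt_id _, by simp⟩
  | succ n ih =>
    obtain ⟨L, c, hc, hL, he⟩ := ih
    have hd := hasTorusFDerivAt_standardMap κ (X n) (X (n + 1))
    rw [← hX.iterate_proj n] at hd
    refine ⟨tangentMap (slope κ (X (n + 1))) ∘L L, c * q (n + 1), ?_, ?_, ?_⟩
    rotate_left
    · rw [Function.iterate_succ']
      exact hd.comp hL
    · have := hq.tangentMap_apply (n + 1)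
      rw [ContinuousLinearMap.comp_apply, he, map_smul, this, smul_smul]
      push_cast
      rfl
    · rw [abs_mul, pow_succ]
      exact mul_le_mul hc (hq _).1 (abs_nonneg _) (by positivity)

theorem IsCodedOrbit.hasTorusFDerivAt_iterate_symm (hX : IsCodedOrbit κ u a X)
    (hr : UnstableSlopes (fun n => slope κ (X n)) r) (n : ℕ) :
    ∃ (L : Plane →L[ℝ] Plane) (c : ℝ), |c| ≤ (1 / 2) ^ n ∧
      HasTorusFDerivAt (standardMap κ).symm^[n] L (proj (X 0, X 1)) ∧
      L (r 0, 1) = c • (r (-n), 1) := by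
  induction n with
  | zero => exact ⟨_, 1, by simp, hasTorusFDerivAt_id _, by simp⟩
  | succ n ih =>
    obtain ⟨L, c, hc, hL, he⟩ := ih
    have hd := hasTorusFDerivAt_standardMap_symm κ (X (-n)) (X (-n + 1))
    rw [← hX.iterate_symm_proj n] at hd
    refine ⟨tangentInv (slope κ (X (-n))) ∘L L, c * r (-n), ?_, ?_, ?_⟩
    rotate_left
    · rw [Function.iterate_succ']
      exact hd.comp hL
    · have := hr.tangentInv_apply (-n)
      rw [ContinuousLinearMap.comp_apply, he, map_smul, this, smul_smul]
      push_cast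
      rw [neg_add']
    · rw [abs_mul, pow_succ]
      exact mul_le_mul hc (hr _).1 (abs_nonneg _) (by positivity)

theorem isCompl_span_pair {q r : ℝ} (hq : |q| ≤ 1 / 2) (hr : |r| ≤ 1 / 2) :
    IsCompl (Submodule.span ℝ {((1, q) : Plane)}) (Submodule.span ℝ {((r, 1) : Plane)}) := by
  -- This is the determinant of the two directions, at least 3/4.
  have hdet : 1 - q * r ≠ 0 := by
    have h : |q * r| ≤ 1 / 2 * (1 / 2) := by
      rw [abs_mul]
      exact mul_le_mul hq hr (abs_nonneg _) (by norm_num)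
    have := (abs_le.1 h).2
    linarith
  constructor
  · rw [Submodule.disjoint_def]
    intro v h1 h2
    obtain ⟨s, rfl⟩ := Submodule.mem_span_singleton.1 h1
    obtain ⟨t, ht⟩ := Submodule.mem_span_singleton.1 h2
    have e1 : t * r = s * 1 := congrArg Prod.fst ht
    have e2 : t * 1 = s * q := congrArg Prod.snd ht
    have e3 : s * (1 - q * r) = 0 := by linear_combination -e1 + r * e2
    rw [(mul_eq_zero.1 e3).resolve_right hdet, zero_smul]
  · rw [codisjoint_iff, eq_top_iff]
    rintro ⟨x, y⟩ -
    obtain ⟨k, hk⟩ : ∃ k, k * (1 - q * r) = 1 := ⟨_, inv_mul_cancel₀ hdet⟩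
    refine Submodule.mem_sup.2 ⟨(k * (x - r * y)) • (1, q),
      Submodule.smul_mem _ _ (Submodule.mem_span_singleton_self _),
      (k * (y - q * x)) • (r, 1),
      Submodule.smul_mem _ _ (Submodule.mem_span_singleton_self _), ?_⟩
    ext
    · simp only [Prod.fst_add, Prod.smul_fst, smul_eq_mul]
      linear_combination x * hk
    · simp only [Prod.snd_add, Prod.smul_snd, smul_eq_mul]
      linear_combination y * hk

theorem norm_one_prod {t : ℝ} (ht : |t| ≤ 1 / 2) : ‖((1, t) : Plane)‖ = 1 := by
  rw [Prod.norm_def, norm_one, Real.norm_eq_abs]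
  exact max_eq_left (by linarith)

theorem norm_prod_one {t : ℝ} (ht : |t| ≤ 1 / 2) : ‖((t, 1) : Plane)‖ = 1 := by
  rw [Prod.norm_def, norm_one, Real.norm_eq_abs]
  exact max_eq_right (by linarith)

theorem norm_apply_le_of_mem_span {L : Plane →L[ℝ] Plane} {e e' v : Plane} {c C : ℝ}
    (he : ‖e‖ = 1) (he' : ‖e'‖ = 1) (hL : L e = c • e') (hc : |c| ≤ C)
    (hv : v ∈ Submodule.span ℝ {e}) : ‖L v‖ ≤ 1 * C * ‖v‖ := by
  obtain ⟨t, rfl⟩ := Submodule.mem_span_singleton.1 hv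
  rw [map_smul, hL, norm_smul, norm_smul, norm_smul, he, he', Real.norm_eq_abs c]
  nlinarith [norm_nonneg t]

theorem span_singleton_smul_eq_of_ne {c : ℝ} (hc : c ≠ 0) (e : Plane) :
    Submodule.span ℝ {c • e} = Submodule.span ℝ {e} :=
  Submodule.span_singleton_smul_eq (IsUnit.mk0 c hc) e

end Splitting

theorem isHyperbolicSet_codedSet {κ : ℝ} (hκ : 3000 ≤ κ) :
    IsHyperbolicSet (standardMap κ) (codedSet κ) := by
  -- `C = 1` suffices because `(1, q)` and `(r, 1)` have maximum norm exactly 1.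
  refine ⟨isCompact_codedSet hκ, image_codedSet κ, ?_, stableSpace κ, unstableSpace κ, 1, 1 / 2,
    by norm_num, by norm_num, by norm_num, ?_⟩
  · rintro _ ⟨u, a, X, ha, hX, rfl⟩
    exact ⟨⟨_, hasTorusFDerivAt_standardMap κ _ _⟩, ⟨_, hasTorusFDerivAt_standardMap_symm κ _ _⟩⟩
  rintro _ ⟨u, a, X, ha, hX, rfl⟩
  have hb : ∀ n, 4 ≤ |slope κ (X n)| := fun n =>
    four_le_slope hκ (le_abs_sin_of_abs_cos_le hκ (hX.abs_cos_lift_le ha hκ n))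
  obtain ⟨q, hq⟩ := exists_stableSlopes hb
  obtain ⟨r, hr⟩ := exists_unstableSlopes hb
  have hs0 := stableSpace_eq hX hq 0
  have hs1 := stableSpace_eq hX hq 1
  have hu0 := unstableSpace_eq hX hr 0
  have hu1 := unstableSpace_eq hX hr 1
  have hmap := hX.map_proj 0
  rw [zero_add] at hs0 hu0 hmap
  rw [hmap, (hasTorusFDerivAt_standardMap κ (X 0) (X 1)).torusFDeriv_eq, hs0, hs1, hu0, hu1]
  refine ⟨isCompl_span_pair (hq 1).1 (hr 0).1, ?_, ?_, fun n v hv => ?_, fun n v hv => ?_⟩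
  -- A nonzero multiplier makes the image of the line the whole next line.
  · have h0 : q 1 ≠ 0 := left_ne_zero_of_mul (by rw [(hq 1).2]; exact one_ne_zero)
    rw [Submodule.map_span, image_singleton, ← span_singleton_smul_eq_of_ne h0 (1, q (1 + 1))]
    congr 2
    exact hq.tangentMap_apply 1
  · have h0 : r 1 ≠ 0 := left_ne_zero_of_mul (by rw [(hr 1).2]; exact one_ne_zero)
    have h1 := hr.tangentMap_apply 1
    rw [sub_self] at h1
    rw [Submodule.map_span, image_singleton, ← h1]
    exact (span_singleton_smul_eq_of_ne h0 _).symm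
  · obtain ⟨L, c, hc, hL, he⟩ := hX.hasTorusFDerivAt_iterate hq n
    rw [hL.torusFDeriv_eq]
    exact norm_apply_le_of_mem_span (norm_one_prod (hq 1).1) (norm_one_prod (hq _).1) he hc hv
  · obtain ⟨L, c, hc, hL, he⟩ := hX.hasTorusFDerivAt_iterate_symm hr n
    rw [hL.torusFDeriv_eq]
    exact norm_apply_le_of_mem_span (norm_prod_one (hr 0).1) (norm_prod_one (hr _).1) he hc hv

end StandardFamily

theorem mainTheorem4 :
    ∃ (κ₀ K : ℝ) (Λ : ℝ → Set Torus) (ι : ℝ → ℝ → Torus → Torus),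
      1 < κ₀ ∧ 0 < K ∧
      (∀ κ : ℝ, κ₀ ≤ κ →
        IsLocallyMaximalHyperbolicSet (standardMap κ) (Λ κ) ∧
        Λ κ ⊆ (criticalSet κ)ᶜ) ∧
      (∀ κs : ℝ, κ₀ ≤ κs →
        (∀ κ : ℝ, κs < κ →
          MapsTo (ι κs κ) (Λ κs) (Λ κ) ∧
          InjOn (ι κs κ) (Λ κs) ∧
          ∀ p ∈ Λ κs, ι κs κ (standardMap κs p) = standardMap κ (ι κs κ p)) ∧
        ∀ p ∈ Λ κs, ι κs κs p = p ∧ SmoothTorusCurveOn (fun κ => ι κs κ p) (Ici κs)) ∧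
      (∀ κ : ℝ, κ₀ ≤ κ → ∀ q : Torus, ∃ p ∈ Λ κ, dist q p ≤ K * κ ^ (-(1 / 2) : ℝ)) := by
  -- From 3000 on, the bound `κ - 2000` on the translations is positive and `1998/κ ≤ 1`.
  refine ⟨3000, 16, codedSet, continuation, by norm_num, by norm_num, fun κ hκ => ?_,
    fun κs hκs => ⟨fun κ hκ => ?_, fun p hp => ?_⟩, fun κ hκ q => codedSet_dense hκ q⟩
  · exact ⟨⟨isHyperbolicSet_codedSet hκ, codedSet_locallyMaximal hκ⟩,
      codedSet_subset_compl_criticalSet hκ⟩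
  · exact ⟨mapsTo_continuation hκs hκ.le, injOn_continuation hκs hκ.le,
      fun p hp => continuation_standardMap hκs hκ.le hp⟩
  · exact ⟨continuation_self hκs hp, smooth_continuation hκs hp⟩
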